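/- Let $\mathbb{H}^2=\mathbb{R}^8$ have coordinates $q_0=x_0+x_1i+x_2j+x_3k$, $q_1=x_4+x_5i+x_6j+x_7k$, Euclidean metric $e$ and $R=\sum x_i^2$. Let $Y_1,Y_2,Y_3$ be the vector fields $q\mapsto qi,\,qj,\,qk$, let $X$ be $q\mapsto iq$, and put $\hat\alpha_i=R^{-1}e(Y_i,\cdot)$. On the cone $\mathscr{C}=\mathbb{R}^+\times\mathbb{CP}^3=(\mathbb{R}^8\setminus 0)/U(1)$, the quotient by the circle generated by $Y_1$, consider the conical $G_2$ structure whose pullback to $\mathbb{R}^8\setminus0$ is $$\varphi=d\big(\tfrac13R^3\omega\big),\quad \omega=d\hat\alpha_1+3\,\hat\alpha_2\wedge\hat\alpha_3,\qquad h_2=dR^2+R^2\big(s_4+\hat\alpha_2^2+\hat\alpha_3^2\big),$$ where $2s_7=s_4+2(\hat\alpha_1^2+\hat\alpha_2^2+\hat\alpha_3^2)$ and $s_7=R^{-1}\big(e-\tfrac1{4R}dR^2\big)$ is the round metric of $S^7$. The circle generated by $X$ acts on $\mathscr{C}$, with quotient map induced by $x\mapsto(\mathbf{u},\mathbf{v})\in\mathbb{R}^3\times\mathbb{R}^3$,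 $$\mathbf{u}=\big(x_0^2+x_1^2-x_4^2-x_5^2,\ 2(x_0x_4+x_1x_5),\ 2(x_0x_5-x_1x_4)\big),$$ $$\mathbf{v}=\big(x_2^2+x_3^2-x_6^2-x_7^2,\ 2(x_2x_6+x_3x_7),\ 2(x_2x_7-x_3x_6)\big),$$ so the quotient is $\mathscr{M}=\mathbb{R}^6\setminus0$, with smooth locus $\mathscr{M}'=\{\mathbf{u}\ne0,\ \mathbf{v}\ne0\}$. Let $N=h_2(X,X)$ and $\theta=N^{-1}h_2(X,\cdot)$. Then $N$ descends to $\mathscr{M}'$, and a metric $g_2$ and forms $\sigma,\psi^-$ on $\mathscr{M}'$ are uniquely determined by (omitting pullbacks) $$h_2=g_2+N\,\theta\otimes\theta,\qquad \sigma=X\lrcorner\,\varphi,\qquad \varphi=\theta\wedge\sigma+N^{-3/4}\psi^-.$$ There is a unique endomorphism field $\mathbb{J}$ of $T\mathscr{M}'$ with $\sigma(W,Y)=N^{1/2}g_2(\mathbb{J}W,Y)$, and it is a smooth almost complex structure. The almost complex structure $\mathbb{J}$ is not integrable: it is not the case that every point of $\mathscr{M}'$ has a neighbourhood with $\mathbb{J}$-holomorphic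 coordinates, and the Nijenhuis tensor of $\mathbb{J}$ does not vanish identically. Moreover $d(N^{-1/4}\psi^-)\neq0$ at the point $\mathbf{u}=\mathbf{v}=(1,2,2)$, and also at the point $\mathbf{u}=\mathbf{v}=(2,2,1)$. -/

import Mathlib

open scoped ContDiff

namespace G2Cone

noncomputable section

/-! ### Linear algebra of forms -/

section Forms

variable {E : Type*} [NormedAddCommGroup E] [NormedSpace ℝ E]

/-- A covector, regarded as an alternating 1-form. -/
def form1 (α : E →L[ℝ] ℝ) : E [⋀^Fin 1]→L[ℝ] ℝ :=
  ContinuousAlternatingMap.ofSubsingleton ℝ E ℝ (0 : Fin 1) α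

/-- The wedge product `α ∧ β` of a covector `α` with an alternating `n`-form `β`:
`(α ∧ β)(v₀,…,vₙ) = ∑ᵢ (-1)ⁱ α(vᵢ) β(v₀,…,v̂ᵢ,…,vₙ)`. -/
def wedge {n : ℕ} (α : E →L[ℝ] ℝ) (β : E [⋀^Fin n]→L[ℝ] ℝ) : E [⋀^Fin (n + 1)]→L[ℝ] ℝ :=
  ContinuousAlternatingMap.alternatizeUncurryFin (α.smulRight β)

/-- The tensor product `α ⊗ β` of two covectors, as a bilinear form. -/
def tensor (α β : E →L[ℝ] ℝ) : E →L[ℝ] E →L[ℝ] ℝ := α.smulRight β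

end Forms

/-! ### The cone over `ℂℙ³`, described on `ℝ⁸ = ℍ²`

Tensors on the cone `ℝ⁺ × ℂℙ³ = (ℝ⁸ ∖ 0) / U(1)` (the quotient by the circle generated by `Y₁`)
are represented by their pullbacks to `ℝ⁸ ∖ 0`. -/

/-- `ℝ⁸`; its (sup) norm is only used for its topology, the Euclidean metric is `eucl`. -/
abbrev R8 : Type := Fin 8 → ℝ

/-- `ℝ³ × ℝ³`, with points `(𝐮, 𝐯)`; its norm is only used for its topology. -/
abbrev R6 : Type := (Fin 3 → ℝ) × (Fin 3 → ℝ)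

/-- The Euclidean metric `e = ∑ dxᵢ ⊗ dxᵢ` on `ℝ⁸`. -/
def eucl : R8 →L[ℝ] R8 →L[ℝ] ℝ :=
  ∑ i : Fin 8, tensor (ContinuousLinearMap.proj i) (ContinuousLinearMap.proj i)

/-- The square `R` of the Euclidean norm. -/
def R (x : R8) : ℝ := ∑ i, x i ^ 2

/-- The 1-form `dR`. -/
def dR (x : R8) : R8 →L[ℝ] ℝ := fderiv ℝ R x

/-- The Killing fields `Y₁, Y₂, Y₃` of the right action of `Sp(1)` on `ℍ²`, where
`q₀ = x₀ + x₁ i + x₂ j + x₃ k` and `q₁ = x₄ + x₅ i + x₆ j + x₇ k`; they are `q ↦ q i, q j, q k`. -/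
def Y1 (x : R8) : R8 := ![-x 1, x 0, x 3, -x 2, -x 5, x 4, x 7, -x 6]

/-- See `Y1`. -/
def Y2 (x : R8) : R8 := ![-x 2, -x 3, x 0, x 1, -x 6, -x 7, x 4, x 5]

/-- See `Y1`. -/
def Y3 (x : R8) : R8 := ![-x 3, x 2, -x 1, x 0, -x 7, x 6, -x 5, x 4]

/-- The Killing field `X` of the left action `q ↦ e^{it} q` of `U(1)` on `ℍ²`: `q ↦ i q`. -/
def X (x : R8) : R8 := ![-x 1, x 0, -x 3, x 2, -x 5, x 4, -x 7, x 6]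

/-- The normalized 1-forms `α̂ᵢ = R⁻¹ αᵢ`, where `αᵢ = e(Yᵢ, ·)`. -/
def alphaHat1 (x : R8) : R8 →L[ℝ] ℝ := (R x)⁻¹ • eucl (Y1 x)

/-- See `alphaHat1`. -/
def alphaHat2 (x : R8) : R8 →L[ℝ] ℝ := (R x)⁻¹ • eucl (Y2 x)

/-- See `alphaHat1`. -/
def alphaHat3 (x : R8) : R8 →L[ℝ] ℝ := (R x)⁻¹ • eucl (Y3 x)

/-- The nearly-Kähler 2-form of `ℂℙ³`: `ω = dα̂₁ + 3 α̂₂ ∧ α̂₃`. -/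
def omega (x : R8) : R8 [⋀^Fin 2]→L[ℝ] ℝ :=
  extDeriv (fun y => form1 (alphaHat1 y)) x + (3 : ℝ) • wedge (alphaHat2 x) (form1 (alphaHat3 x))

/-- The 3-form of the conical `G₂` structure: `φ = d(⅓ R³ ω)`. -/
def phi : R8 → R8 [⋀^Fin 3]→L[ℝ] ℝ :=
  extDeriv (fun x => ((1 / 3 : ℝ) * R x ^ 3) • omega x)

/-- The round metric of `S⁷`, pulled back by `x ↦ x / r` with `r = √R`, that is
`s₇ = r⁻² (e - dr²)`, where `dr² = dR² / (4R)`. -/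
def s7 (x : R8) : R8 →L[ℝ] R8 →L[ℝ] ℝ :=
  (R x)⁻¹ • (eucl - (4 * R x)⁻¹ • tensor (dR x) (dR x))

/-- The pullback of the round metric of `S⁴` by the Hopf fibration `S⁷ → S⁴`, with the scale
fixed by `2 s₇ = s₄ + 2 (α̂₁² + α̂₂² + α̂₃²)`. -/
def s4 (x : R8) : R8 →L[ℝ] R8 →L[ℝ] ℝ :=
  (2 : ℝ) • s7 x - (2 : ℝ) • (tensor (alphaHat1 x) (alphaHat1 x)
    + tensor (alphaHat2 x) (alphaHat2 x) + tensor (alphaHat3 x) (alphaHat3 x))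

/-- The nearly-Kähler metric `s₄ + α̂₂² + α̂₃²` of `ℂℙ³`, the one attached to `ω`. -/
def nearlyKahler (x : R8) : R8 →L[ℝ] R8 →L[ℝ] ℝ :=
  s4 x + tensor (alphaHat2 x) (alphaHat2 x) + tensor (alphaHat3 x) (alphaHat3 x)

/-- The conical metric with holonomy `G₂`, that is `h₂ = dR² + R² (s₄ + α̂₂² + α̂₃²)`; it is the
metric determined by `φ`. -/
def h2 (x : R8) : R8 →L[ℝ] R8 →L[ℝ] ℝ :=
  tensor (dR x) (dR x) + (R x ^ 2) • nearlyKahler x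

/-! ### Tensors on the cone that descend to the circle quotient -/

/-- `N = h₂(X, X)`, before descent. -/
def normSqX (x : R8) : ℝ := h2 x (X x) (X x)

/-- The connection form `θ = N⁻¹ h₂(X, ·)`, normalized by `θ(X) = 1`. -/
def theta (x : R8) : R8 →L[ℝ] ℝ := (normSqX x)⁻¹ • h2 x (X x)

/-- The part of `h₂` that is horizontal for the circle action: `h₂ - N θ ⊗ θ`. -/
def horizontalMetric (x : R8) : R8 →L[ℝ] R8 →L[ℝ] ℝ :=
  h2 x - normSqX x • tensor (theta x) (theta x)

/-- The 2-form `X ⌟ φ`. -/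
def contractedForm (x : R8) : R8 [⋀^Fin 2]→L[ℝ] ℝ := (phi x).curryLeft (X x)

/-- The form `ψ⁻` before descent, given by `φ = θ ∧ (X ⌟ φ) + N^{-3/4} ψ⁻`. -/
def psiMinusUp (x : R8) : R8 [⋀^Fin 3]→L[ℝ] ℝ :=
  (normSqX x ^ (3 / 4 : ℝ)) • (phi x - wedge (theta x) (contractedForm x))

/-! ### The quotient -/

/-- The quotient map `ℝ⁸ → ℝ⁶`, `x ↦ (𝐮, 𝐯)`, for the action of the torus `U(1) × U(1)` generated
by `X` and `Y₁`; it consists of the hyperkähler moment maps of `(X + Y₁)/2` and `(X - Y₁)/2`, and it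
induces the map from the cone to its circle quotient `ℝ⁶ ∖ 0`. -/
def Q (x : R8) : R6 :=
  (![x 0 ^ 2 + x 1 ^ 2 - x 4 ^ 2 - x 5 ^ 2, 2 * (x 0 * x 4 + x 1 * x 5),
      2 * (x 0 * x 5 - x 1 * x 4)],
   ![x 2 ^ 2 + x 3 ^ 2 - x 6 ^ 2 - x 7 ^ 2, 2 * (x 2 * x 6 + x 3 * x 7),
      2 * (x 2 * x 7 - x 3 * x 6)])

/-- The smooth locus of the quotient, over which the circle action has no fixed points: the
complement of `ℝ³ ∪ ℝ³` in `ℝ⁶`. -/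
def smoothLocus : Set R6 := {m | m.1 ≠ 0 ∧ m.2 ≠ 0}

/-- The number `c` is the value at `m` of the function on the quotient that pulls back to `f`. -/
def IsPushdownFun (f : R8 → ℝ) (m : R6) (c : ℝ) : Prop :=
  ∀ x, Q x = m → c = f x

/-- The bilinear form `b` is the value at `m` of the tensor on the quotient that pulls back
to `T`. -/
def IsPushdownBilin (T : R8 → R8 →L[ℝ] R8 →L[ℝ] ℝ) (m : R6) (b : R6 →L[ℝ] R6 →L[ℝ] ℝ) : Prop :=
  ∀ x, Q x = m → ∀ v w, b (fderiv ℝ Q x v) (fderiv ℝ Q x w) = T x v w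

/-- The alternating form `β` is the value at `m` of the differential form on the quotient that pulls
back to `η`. -/
def IsPushdownForm {k : ℕ} (η : R8 → R8 [⋀^Fin k]→L[ℝ] ℝ) (m : R6)
    (β : R6 [⋀^Fin k]→L[ℝ] ℝ) : Prop :=
  ∀ x, Q x = m → β.compContinuousLinearMap (fderiv ℝ Q x) = η x

/-- The function `N` on the quotient, the squared length of `X`. -/
def N (m : R6) : ℝ := Classical.epsilon (IsPushdownFun normSqX m)

/-- The metric `g₂` on the quotient, the pushdown of `h₂`: `h₂ = Q^* g₂ + N θ ⊗ θ`. -/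
def g2 (m : R6) : R6 →L[ℝ] R6 →L[ℝ] ℝ := Classical.epsilon (IsPushdownBilin horizontalMetric m)

/-- The symplectic form `σ` on the quotient: `Q^* σ = X ⌟ φ`. -/
def sigma (m : R6) : R6 [⋀^Fin 2]→L[ℝ] ℝ := Classical.epsilon (IsPushdownForm contractedForm m)

/-- The 3-form `ψ⁻` on the quotient: `φ = θ ∧ Q^* σ + N^{-3/4} Q^* ψ⁻`. -/
def psiMinus (m : R6) : R6 [⋀^Fin 3]→L[ℝ] ℝ := Classical.epsilon (IsPushdownForm psiMinusUp m)

/-- The endomorphism `A` of the tangent space at `m` satisfies `σ(W, Y) = N^{1/2} g₂(A W, Y)`. -/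
def IsInducedJ (m : R6) (A : R6 →L[ℝ] R6) : Prop :=
  ∀ W Y : R6, sigma m ![W, Y] = N m ^ (1 / 2 : ℝ) * g2 m (A W) Y

/-- The almost complex structure `𝕁` induced on the quotient. -/
def J (m : R6) : R6 →L[ℝ] R6 := Classical.epsilon (IsInducedJ m)

/-! ### Integrability -/

/-- An almost complex structure `A` on an open subset `U` of `ℝ⁶` is integrable if every point
of `U` has an open neighbourhood with complex coordinates `f = (f₁, f₂, f₃)` that are holomorphic
for `A`, that is `df ∘ A = i df`. -/
def IsIntegrableOn (A : R6 → R6 →L[ℝ] R6) (U : Set R6) : Prop :=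
  ∀ m ∈ U, ∃ V : Set R6, IsOpen V ∧ m ∈ V ∧ V ⊆ U ∧
    ∃ f : R6 → (Fin 3 → ℂ), ContDiffOn ℝ ∞ f V ∧
      ∀ y ∈ V, Function.Bijective (fderiv ℝ f y) ∧
        ∀ w, fderiv ℝ f y (A y w) = Complex.I • fderiv ℝ f y w

/-- The Nijenhuis tensor `[AV, AW] - A[AV, W] - A[V, AW] - [V, W]` of `A` at `m`, computed with the
constant vector fields `V`, `W` of values `v`, `w`. -/
def nijenhuis (A : R6 → R6 →L[ℝ] R6) (m v w : R6) : R6 :=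
  let V : R6 → R6 := fun _ => v
  let W : R6 → R6 := fun _ => w
  let AV : R6 → R6 := fun y => A y v
  let AW : R6 → R6 := fun y => A y w
  VectorField.lieBracket ℝ AV AW m - A m (VectorField.lieBracket ℝ AV W m)
    - A m (VectorField.lieBracket ℝ V AW m) - VectorField.lieBracket ℝ V W m

end

end G2Cone

open G2Cone

/-! On ℝ⁸ every tensor is elementary: `h2_apply` and `phi_apply` write h₂ and φ as polynomials in R,
the Euclidean product and three skew forms αᵢ. The map Q is a pair of Hopf maps ℝ⁴ → ℝ³, on the
halves (x₀,x₁,x₄,x₅) and (x₂,x₃,x₆,x₇). Over the smooth locus its fibres are orbits of a 2-torus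
(`exists_torus`) and ker dQ is spanned by X and Y₁ (`mem_ker_fderiv_Q`). A tensor that is torus
invariant and killed by X and Y₁ therefore descends, uniquely because dQ is onto. This gives g₂, σ
and ψ⁻; N descends through its formula.

On the quotient N = 6|𝐮||𝐯| − 2𝐮·𝐯 (`N_eq`) and σ is explicit (`sigma_eq`). The metric g₂ is known
through its inverse: the h₂-dual of a pulled-back covector is horizontal, and dQ maps it to the
g₂-dual (`g2_sharp`). Raising an index of σ gives 𝕁 in the closed form `Jexp`, whence smoothness; 𝕁²
= −1 is an identity among scalar products (`rotNum_rot`).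

Holomorphic coordinates would make the Nijenhuis tensor vanish (`nijenhuis_eq_zero`), so one nonzero
component, found at 𝐮 = 𝐯 = (3,0,0) (`nijenhuis_axisPoint`), disproves integrability. The form
N^{-1/4}ψ⁻ pulls back to N^{1/2}(φ − θ ∧ (X ⌟ φ)), and d commutes with pullback; so it suffices that
d of the latter is nonzero on four vectors of ℝ⁸ at one point of the fibre. At all three points 𝐮 =
𝐯 has length 3, so N = 36 and |𝐮|, |𝐯|, √N are rational. -/

namespace G2Cone

/-! ### Wedge products and exterior derivatives on fixed vectors -/

section FormAlgebra

variable {E : Type*} [NormedAddCommGroup E] [NormedSpace ℝ E]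

/-- `form1` as a continuous linear map. -/
noncomputable def form1L (E : Type*) [NormedAddCommGroup E] [NormedSpace ℝ E] :
    (E →L[ℝ] ℝ) →L[ℝ] E [⋀^Fin 1]→L[ℝ] ℝ :=
  (ContinuousAlternatingMap.ofSubsingletonLIE (𝕜 := ℝ) (E := E) (F := ℝ)
    (0 : Fin 1)).toContinuousLinearEquiv.toContinuousLinearMap

theorem form1L_apply (α : E →L[ℝ] ℝ) : form1L E α = form1 α := rfl

theorem form1_apply (α : E →L[ℝ] ℝ) (v : Fin 1 → E) : form1 α v = α (v 0) := rfl

theorem wedge_apply {n : ℕ} (α : E →L[ℝ] ℝ) (β : E [⋀^Fin n]→L[ℝ] ℝ) (v : Fin (n + 1) → E) :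
    wedge α β v = ∑ i : Fin (n + 1), (-1) ^ i.val * (α (v i) * β (i.removeNth v)) := by
  simp [wedge, ContinuousAlternatingMap.alternatizeUncurryFin_apply]

theorem wedge_form1_apply (α β : E →L[ℝ] ℝ) (a b : E) :
    wedge α (form1 β) ![a, b] = α a * β b - α b * β a := by
  simp [wedge_apply, Fin.sum_univ_two, form1_apply, Fin.removeNth, Fin.succAbove]
  ring

theorem wedge_two_apply (α : E →L[ℝ] ℝ) (β : E [⋀^Fin 2]→L[ℝ] ℝ) (a b c : E) :
    wedge α β ![a, b, c] = α a * β ![b, c] - α b * β ![a, c] + α c * β ![a, b] := by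
  have h0 : (0 : Fin 3).removeNth ![a, b, c] = ![b, c] := by
    ext i; fin_cases i <;> rfl
  have h1 : (1 : Fin 3).removeNth ![a, b, c] = ![a, c] := by
    ext i; fin_cases i <;> rfl
  have h2 : (2 : Fin 3).removeNth ![a, b, c] = ![a, b] := by
    ext i; fin_cases i <;> rfl
  rw [wedge_apply, Fin.sum_univ_three, h0, h1, h2]
  simp
  ring

/-- Leibniz rule for the product of a function and a form. -/
theorem extDeriv_smul_form {n : ℕ} {f : E → ℝ} {η : E → E [⋀^Fin n]→L[ℝ] ℝ} {x : E}
    (hf : DifferentiableAt ℝ f x) (hη : DifferentiableAt ℝ η x) :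
    extDeriv (fun y => f y • η y) x = wedge (fderiv ℝ f x) (η x) + f x • extDeriv η x := by
  rw [extDeriv, fderiv_fun_smul hf hη, ContinuousAlternatingMap.alternatizeUncurryFin_add,
    ContinuousAlternatingMap.alternatizeUncurryFin_smul]
  exact add_comm _ _

theorem extDeriv_clm {n : ℕ} (η : E →L[ℝ] E [⋀^Fin n]→L[ℝ] ℝ) (x : E) :
    extDeriv (fun y => η y) x = ContinuousAlternatingMap.alternatizeUncurryFin η := by
  rw [extDeriv, ContinuousLinearMap.fderiv]

theorem contDiffAt_wedge {F : Type*} [NormedAddCommGroup F] [NormedSpace ℝ F] {n : ℕ}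
    {k : WithTop ℕ∞} {α : F → E →L[ℝ] ℝ} {β : F → E [⋀^Fin n]→L[ℝ] ℝ} {x : F}
    (hα : ContDiffAt ℝ k α x) (hβ : ContDiffAt ℝ k β x) :
    ContDiffAt ℝ k (fun y => wedge (α y) (β y)) x := by
  unfold wedge
  have := (hα.smulRight hβ)
  exact (ContinuousAlternatingMap.alternatizeUncurryFinCLM ℝ E ℝ).contDiff.contDiffAt.comp x this

/-- With constant vectors in the slots no bracket terms appear, so d reduces to directional
derivatives of scalar functions. -/
theorem extDeriv_two_apply {η : E → E [⋀^Fin 2]→L[ℝ] ℝ} {x : E} (h : DifferentiableAt ℝ η x)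
    (a b c : E) : extDeriv η x ![a, b, c] = fderiv ℝ (fun y => η y ![b, c]) x a
      - fderiv ℝ (fun y => η y ![a, c]) x b + fderiv ℝ (fun y => η y ![a, b]) x c := by
  have h0 : (0 : Fin 3).removeNth ![a, b, c] = ![b, c] := by
    ext i; fin_cases i <;> rfl
  have h1 : (1 : Fin 3).removeNth ![a, b, c] = ![a, c] := by
    ext i; fin_cases i <;> rfl
  have h2 : (2 : Fin 3).removeNth ![a, b, c] = ![a, b] := by
    ext i; fin_cases i <;> rfl
  rw [extDeriv_apply h, Fin.sum_univ_three, h0, h1, h2]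
  simp
  ring

theorem extDeriv_three_apply {η : E → E [⋀^Fin 3]→L[ℝ] ℝ} {x : E} (h : DifferentiableAt ℝ η x)
    (a b c d : E) : extDeriv η x ![a, b, c, d] = fderiv ℝ (fun y => η y ![b, c, d]) x a
      - fderiv ℝ (fun y => η y ![a, c, d]) x b + fderiv ℝ (fun y => η y ![a, b, d]) x c
      - fderiv ℝ (fun y => η y ![a, b, c]) x d := by
  have h0 : (0 : Fin 4).removeNth ![a, b, c, d] = ![b, c, d] := by
    ext i; fin_cases i <;> rfl
  have h1 : (1 : Fin 4).removeNth ![a, b, c, d] = ![a, c, d] := by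
    ext i; fin_cases i <;> rfl
  have h2 : (2 : Fin 4).removeNth ![a, b, c, d] = ![a, b, d] := by
    ext i; fin_cases i <;> rfl
  have h3 : (3 : Fin 4).removeNth ![a, b, c, d] = ![a, b, c] := by
    ext i; fin_cases i <;> rfl
  rw [extDeriv_apply h, Fin.sum_univ_four, h0, h1, h2, h3]
  simp
  ring

end FormAlgebra

/-! ### Polynomial formulas for h₂ and φ on ℝ⁸ -/

theorem eucl_apply (a b : R8) : eucl a b = a 0 * b 0 + a 1 * b 1 + a 2 * b 2 + a 3 * b 3
    + a 4 * b 4 + a 5 * b 5 + a 6 * b 6 + a 7 * b 7 := by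
  simp [eucl, tensor, Fin.sum_univ_eight]

theorem eucl_comm (a b : R8) : eucl a b = eucl b a := by
  simp only [eucl_apply]; ring

theorem R_eq (x : R8) : R x = eucl x x := by
  simp only [eucl_apply, R, Fin.sum_univ_eight]; ring

theorem hasFDerivAt_R (x : R8) : HasFDerivAt R ((2 : ℝ) • eucl x) x := by
  have h := (eucl.hasFDerivAt (x := x)).clm_apply (hasFDerivAt_id x)
  have hR : R = fun y => eucl y (id y) := funext R_eq
  rw [hR]
  refine h.congr_fderiv ?_
  ext v
  simp [eucl_comm v x]
  ring

theorem dR_eq (x : R8) : dR x = (2 : ℝ) • eucl x := (hasFDerivAt_R x).fderiv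

/-- `Y1`, `Y2`, `Y3` as continuous linear maps. -/
noncomputable def Y1L : R8 →L[ℝ] R8 := LinearMap.toContinuousLinearMap
  { toFun := Y1
    map_add' := fun a b => by ext i; fin_cases i <;> simp [Y1] <;> ring
    map_smul' := fun a b => by ext i; fin_cases i <;> simp [Y1] }

/-- See `Y1L`. -/
noncomputable def Y2L : R8 →L[ℝ] R8 := LinearMap.toContinuousLinearMap
  { toFun := Y2
    map_add' := fun a b => by ext i; fin_cases i <;> simp [Y2] <;> ring
    map_smul' := fun a b => by ext i; fin_cases i <;> simp [Y2] }

/-- See `Y1L`. -/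
noncomputable def Y3L : R8 →L[ℝ] R8 := LinearMap.toContinuousLinearMap
  { toFun := Y3
    map_add' := fun a b => by ext i; fin_cases i <;> simp [Y3] <;> ring
    map_smul' := fun a b => by ext i; fin_cases i <;> simp [Y3] }

/-- The Killing field `X` as a continuous linear map. -/
noncomputable def XL : R8 →L[ℝ] R8 := LinearMap.toContinuousLinearMap
  { toFun := X
    map_add' := fun a b => by ext i; fin_cases i <;> simp [X] <;> ring
    map_smul' := fun a b => by ext i; fin_cases i <;> simp [X] }

/-- The covectors `αᵢ = e(Yᵢ, ·)`, depending linearly on the point. -/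
noncomputable def alpha1 : R8 →L[ℝ] R8 →L[ℝ] ℝ := eucl.comp Y1L
/-- See `alpha1`. -/
noncomputable def alpha2 : R8 →L[ℝ] R8 →L[ℝ] ℝ := eucl.comp Y2L
/-- See `alpha1`. -/
noncomputable def alpha3 : R8 →L[ℝ] R8 →L[ℝ] ℝ := eucl.comp Y3L

theorem alpha1_eq (x : R8) : alpha1 x = eucl (Y1 x) := rfl
theorem alpha2_eq (x : R8) : alpha2 x = eucl (Y2 x) := rfl
theorem alpha3_eq (x : R8) : alpha3 x = eucl (Y3 x) := rfl

theorem alpha1_apply (x a : R8) : alpha1 x a = -x 1 * a 0 + x 0 * a 1 + x 3 * a 2 - x 2 * a 3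
    - x 5 * a 4 + x 4 * a 5 + x 7 * a 6 - x 6 * a 7 := by
  simp [alpha1_eq, eucl_apply, Y1]; ring

theorem alpha2_apply (x a : R8) : alpha2 x a = -x 2 * a 0 - x 3 * a 1 + x 0 * a 2 + x 1 * a 3
    - x 6 * a 4 - x 7 * a 5 + x 4 * a 6 + x 5 * a 7 := by
  simp [alpha2_eq, eucl_apply, Y2]; ring

theorem alpha3_apply (x a : R8) : alpha3 x a = -x 3 * a 0 + x 2 * a 1 - x 1 * a 2 + x 0 * a 3
    - x 7 * a 4 + x 6 * a 5 - x 5 * a 6 + x 4 * a 7 := by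
  simp [alpha3_eq, eucl_apply, Y3]; ring

/-- The round part 2R²s₇ contributes 2R e − 2⟨x,·⟩² and dR² contributes 4⟨x,·⟩²; the squares of α₂
and α₃ enter with coefficient −2 + 1. -/
theorem h2_apply {x : R8} (hx : R x ≠ 0) (a b : R8) : h2 x a b =
    2 * eucl x a * eucl x b + 2 * R x * eucl a b - 2 * alpha1 x a * alpha1 x b
      - alpha2 x a * alpha2 x b - alpha3 x a * alpha3 x b := by
  simp only [h2, nearlyKahler, s4, s7, tensor, dR_eq, alphaHat1, alphaHat2, alphaHat3,
    ← alpha1_eq, ← alpha2_eq, ← alpha3_eq, _root_.add_apply,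
    _root_.sub_apply, _root_.smul_apply,
    ContinuousLinearMap.smulRight_apply, smul_eq_mul]
  field_simp
  ring

/-- The constant 2-form `dα₁`. -/
noncomputable def dAlpha1 : R8 [⋀^Fin 2]→L[ℝ] ℝ :=
  ContinuousAlternatingMap.alternatizeUncurryFin ((form1L R8).comp alpha1)

theorem dAlpha1_apply (a b : R8) : dAlpha1 ![a, b] = 2 * alpha1 a b := by
  have : alpha1 b a = - alpha1 a b := by simp only [alpha1_apply]; ring
  simp [dAlpha1, ContinuousAlternatingMap.alternatizeUncurryFin_apply, Fin.sum_univ_two,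
    form1L_apply, form1_apply, Fin.removeNth, Fin.succAbove, this]
  ring

theorem omega_eq {x : R8} (hx : R x ≠ 0) : omega x = (R x)⁻¹ • dAlpha1
    - ((2 : ℝ) * ((R x) ^ 2)⁻¹) • wedge (eucl x) (form1 (alpha1 x))
    + (3 * ((R x) ^ 2)⁻¹) • wedge (alpha2 x) (form1 (alpha3 x)) := by
  have hR := ((hasDerivAt_inv hx).comp_hasFDerivAt x (hasFDerivAt_R x))
  have h1 : extDeriv (fun y => form1 (alphaHat1 y)) x = extDeriv (fun y => (R y)⁻¹ •
      (form1L R8).comp alpha1 y) x := by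
    congr 1
  have hR' : HasFDerivAt (fun y => (R y)⁻¹) (-(R x ^ 2)⁻¹ • (2 : ℝ) • eucl x) x := hR
  rw [omega, h1, extDeriv_smul_form hR'.differentiableAt
    (ContinuousLinearMap.differentiableAt _), extDeriv_clm, HasFDerivAt.fderiv hR']
  ext v
  simp only [ContinuousAlternatingMap.add_apply, ContinuousAlternatingMap.sub_apply,
    ContinuousAlternatingMap.smul_apply, wedge_apply, alphaHat2, alphaHat3,
    form1_apply, ← alpha2_eq, ← alpha3_eq, _root_.smul_apply, smul_eq_mul, dAlpha1,
    ContinuousLinearMap.comp_apply, form1L_apply]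
  simp
  field_simp
  ring

/-- The primitive `⅓ R³ ω` of `φ`, written polynomially. -/
noncomputable def phiPrimitive (x : R8) : R8 [⋀^Fin 2]→L[ℝ] ℝ :=
  (1 / 3 * R x ^ 2) • dAlpha1 - (2 / 3 * R x) • wedge (eucl x) (form1 (alpha1 x))
    + R x • wedge (alpha2 x) (form1 (alpha3 x))

/-- The factor R³ cancels every denominator of ω. This needs R ≠ 0, an open condition, so the two
primitives agree near x and have the same exterior derivative there. -/
theorem phi_eq {x : R8} (hx : R x ≠ 0) : phi x = extDeriv phiPrimitive x := by
  refine Filter.EventuallyEq.extDeriv_eq ?_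
  filter_upwards [(hasFDerivAt_R x).continuousAt.eventually_ne hx] with y hy
  rw [omega_eq hy, phiPrimitive, smul_add, smul_sub, smul_smul, smul_smul, smul_smul]
  congr 2 <;> [congr 1; congr 1; skip] <;> field_simp

theorem contDiff_R : ContDiff ℝ ∞ R := by
  unfold R; fun_prop

theorem contDiff_phiPrimitive : ContDiff ℝ ∞ phiPrimitive := by
  rw [contDiff_iff_contDiffAt]
  intro x
  have hR := contDiff_R.contDiffAt (x := x)
  have h1 : ContDiffAt ℝ ∞ (fun x => wedge (eucl x) (form1 (alpha1 x))) x :=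
    contDiffAt_wedge eucl.contDiff.contDiffAt (β := fun x => form1 (alpha1 x))
      ((form1L R8).comp alpha1).contDiff.contDiffAt
  have h2 : ContDiffAt ℝ ∞ (fun x => wedge (alpha2 x) (form1 (alpha3 x))) x :=
    contDiffAt_wedge alpha2.contDiff.contDiffAt (β := fun x => form1 (alpha3 x))
      ((form1L R8).comp alpha3).contDiff.contDiffAt
  unfold phiPrimitive
  exact (((contDiffAt_const.mul (hR.pow 2)).smul contDiffAt_const).sub
    ((contDiffAt_const.mul hR).smul h1)).add (hR.smul h2)

theorem phi_contDiffAt {x : R8} (hx : R x ≠ 0) : ContDiffAt ℝ ∞ phi x := by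
  have h : ContDiff ℝ ∞ (extDeriv phiPrimitive) :=
    (ContinuousAlternatingMap.alternatizeUncurryFinCLM ℝ R8 ℝ).contDiff.comp
      (contDiff_phiPrimitive.fderiv_right (by simp))
  refine h.contDiffAt.congr_of_eventuallyEq ?_
  filter_upwards [(hasFDerivAt_R x).continuousAt.eventually_ne hx] with y hy
  exact phi_eq hy

theorem phiPrimitive_apply (x a b : R8) : phiPrimitive x ![a, b] = 2 / 3 * R x ^ 2 * alpha1 a b
    - 2 / 3 * R x * (eucl x a * alpha1 x b - eucl x b * alpha1 x a)
    + R x * (alpha2 x a * alpha3 x b - alpha2 x b * alpha3 x a) := by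
  simp only [phiPrimitive, ContinuousAlternatingMap.add_apply, ContinuousAlternatingMap.sub_apply,
    ContinuousAlternatingMap.smul_apply, wedge_form1_apply, dAlpha1_apply, smul_eq_mul]
  ring

theorem fderiv_phiPrimitive_apply (x a b c : R8) : fderiv ℝ (fun y => phiPrimitive y ![b, c]) x a =
    8 / 3 * R x * eucl x a * alpha1 b c
    - 4 / 3 * eucl x a * (eucl x b * alpha1 x c - eucl x c * alpha1 x b)
    - 2 / 3 * R x * (eucl a b * alpha1 x c + eucl x b * alpha1 a c - eucl a c * alpha1 x b
      - eucl x c * alpha1 a b)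
    + 2 * eucl x a * (alpha2 x b * alpha3 x c - alpha2 x c * alpha3 x b)
    + R x * (alpha2 a b * alpha3 x c + alpha2 x b * alpha3 a c - alpha2 a c * alpha3 x b
      - alpha2 x c * alpha3 a b) := by
  have lin : ∀ (A : R8 →L[ℝ] R8 →L[ℝ] ℝ) (b : R8), HasFDerivAt (fun y => A y b) (A.flip b) x :=
    fun A b => (A.flip b).hasFDerivAt
  have hR := hasFDerivAt_R x
  have h := (((hR.pow 2).const_mul (2 / 3)).mul_const (alpha1 b c)).sub
    ((hR.const_mul (2 / 3)).mul (((lin eucl b).mul (lin alpha1 c)).sub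
      ((lin eucl c).mul (lin alpha1 b)))) |>.add
    (hR.mul (((lin alpha2 b).mul (lin alpha3 c)).sub ((lin alpha2 c).mul (lin alpha3 b))))
  have e : (fun y => phiPrimitive y ![b, c]) = _ := funext fun y => phiPrimitive_apply y b c
  rw [e]
  refine (DFunLike.congr_fun h.fderiv a).trans ?_
  simp
  ring

/-- Right multiplication by i, j or k is skew for the Euclidean metric. -/
theorem alpha_antisymm (a b : R8) :
    alpha1 b a = -alpha1 a b ∧ alpha2 b a = -alpha2 a b ∧ alpha3 b a = -alpha3 a b := by
  simp only [alpha1_apply, alpha2_apply, alpha3_apply]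
  refine ⟨?_, ?_, ?_⟩ <;> ring

theorem phi_apply {x : R8} (hx : R x ≠ 0) (a b c : R8) : phi x ![a, b, c] =
    4 * R x * (eucl x a * alpha1 b c - eucl x b * alpha1 a c + eucl x c * alpha1 a b)
    + 2 * (eucl x a * (alpha2 x b * alpha3 x c - alpha2 x c * alpha3 x b)
      - eucl x b * (alpha2 x a * alpha3 x c - alpha2 x c * alpha3 x a)
      + eucl x c * (alpha2 x a * alpha3 x b - alpha2 x b * alpha3 x a))
    + 2 * R x * (alpha2 a b * alpha3 x c - alpha2 a c * alpha3 x b + alpha2 b c * alpha3 x a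
      - alpha3 a b * alpha2 x c + alpha3 a c * alpha2 x b - alpha3 b c * alpha2 x a) := by
  rw [phi_eq hx, extDeriv_two_apply
    (contDiff_phiPrimitive.contDiffAt.differentiableAt (by simp)),
    fderiv_phiPrimitive_apply, fderiv_phiPrimitive_apply, fderiv_phiPrimitive_apply]
  obtain ⟨h1, h2, h3⟩ := alpha_antisymm a b
  obtain ⟨k1, k2, k3⟩ := alpha_antisymm a c
  obtain ⟨l1, l2, l3⟩ := alpha_antisymm b c
  rw [h1, h2, h3, k1, k2, k3, l1, l2, l3, eucl_comm b a, eucl_comm c a, eucl_comm c b]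
  ring

/-! ### The quotient map and the torus action -/

theorem hasFDerivAt_vec3 {E : Type*} [NormedAddCommGroup E] [NormedSpace ℝ E] {f g h : E → ℝ}
    {f' g' h' : E →L[ℝ] ℝ} {x : E} (hf : HasFDerivAt f f' x) (hg : HasFDerivAt g g' x)
    (hh : HasFDerivAt h h' x) : HasFDerivAt (fun y => (![f y, g y, h y] : Fin 3 → ℝ))
      (ContinuousLinearMap.pi ![f', g', h']) x := by
  rw [hasFDerivAt_pi]
  intro i
  fin_cases i
  exacts [hf, hg, hh]

theorem hasFDerivAt_Q (x : R8) : ∃ D : R8 →L[ℝ] R6, HasFDerivAt Q D x ∧ ∀ a, D a =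
    (![2 * (x 0 * a 0 + x 1 * a 1 - x 4 * a 4 - x 5 * a 5),
       2 * (a 0 * x 4 + x 0 * a 4 + a 1 * x 5 + x 1 * a 5),
       2 * (a 0 * x 5 + x 0 * a 5 - a 1 * x 4 - x 1 * a 4)],
     ![2 * (x 2 * a 2 + x 3 * a 3 - x 6 * a 6 - x 7 * a 7),
       2 * (a 2 * x 6 + x 2 * a 6 + a 3 * x 7 + x 3 * a 7),
       2 * (a 2 * x 7 + x 2 * a 7 - a 3 * x 6 - x 3 * a 6)]) := by
  have p : ∀ i : Fin 8, HasFDerivAt (fun y : R8 => y i)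
    (ContinuousLinearMap.proj (R := ℝ) (φ := fun _ : Fin 8 => ℝ) i) x :=
    fun i => hasFDerivAt_apply i x
  have key : ∀ i j k l : Fin 8, ∃ D : R8 →L[ℝ] (Fin 3 → ℝ),
      HasFDerivAt (fun y : R8 => (![y i ^ 2 + y j ^ 2 - y k ^ 2 - y l ^ 2,
        2 * (y i * y k + y j * y l), 2 * (y i * y l - y j * y k)] : Fin 3 → ℝ)) D x ∧
      ∀ a, D a = ![2 * (x i * a i + x j * a j - x k * a k - x l * a l),
        2 * (a i * x k + x i * a k + a j * x l + x j * a l),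
        2 * (a i * x l + x i * a l - a j * x k - x j * a k)] := fun i j k l => by
    have d0 := ((((p i).pow 2).add ((p j).pow 2)).sub ((p k).pow 2)).sub ((p l).pow 2)
    have d1 := (((p i).mul (p k)).add ((p j).mul (p l))).const_mul 2
    have d2 := (((p i).mul (p l)).sub ((p j).mul (p k))).const_mul 2
    refine ⟨_, hasFDerivAt_vec3 d0 d1 d2, fun a => ?_⟩
    ext n
    fin_cases n <;> simp <;> ring
  obtain ⟨D, hD, hD'⟩ := key 0 1 4 5
  obtain ⟨D', hE, hE'⟩ := key 2 3 6 7
  exact ⟨D.prod D', hD.prodMk hE, fun a => Prod.ext (hD' a) (hE' a)⟩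

theorem fderiv_Q_apply (x a : R8) : fderiv ℝ Q x a =
    (![2 * (x 0 * a 0 + x 1 * a 1 - x 4 * a 4 - x 5 * a 5),
       2 * (a 0 * x 4 + x 0 * a 4 + a 1 * x 5 + x 1 * a 5),
       2 * (a 0 * x 5 + x 0 * a 5 - a 1 * x 4 - x 1 * a 4)],
     ![2 * (x 2 * a 2 + x 3 * a 3 - x 6 * a 6 - x 7 * a 7),
       2 * (a 2 * x 6 + x 2 * a 6 + a 3 * x 7 + x 3 * a 7),
       2 * (a 2 * x 7 + x 2 * a 7 - a 3 * x 6 - x 3 * a 6)]) := by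
  obtain ⟨D, h, hD⟩ := hasFDerivAt_Q x
  rw [h.fderiv, hD]

theorem contDiff_Q : ContDiff ℝ ∞ Q := by
  have p : ∀ i : Fin 8, ContDiff ℝ ∞ (fun y : R8 => y i) := fun i => contDiff_apply ℝ ℝ i
  have key : ∀ i j k l : Fin 8,
      ContDiff ℝ ∞ (fun y : R8 => (![y i ^ 2 + y j ^ 2 - y k ^ 2 - y l ^ 2,
        2 * (y i * y k + y j * y l), 2 * (y i * y l - y j * y k)] : Fin 3 → ℝ)) :=
      fun i j k l => by
    rw [contDiff_pi]
    intro n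
    fin_cases n
    · exact ((((p i).pow 2).add ((p j).pow 2)).sub ((p k).pow 2)).sub ((p l).pow 2)
    · exact contDiff_const.mul (((p i).mul (p k)).add ((p j).mul (p l)))
    · exact contDiff_const.mul (((p i).mul (p l)).sub ((p j).mul (p k)))
  exact (key 0 1 4 5).prodMk (key 2 3 6 7)

/-! ### The two Hopf maps: lengths, sections, surjectivity -/

/-- Euclidean inner product on `ℝ³`. -/
def dot (a b : Fin 3 → ℝ) : ℝ := a 0 * b 0 + a 1 * b 1 + a 2 * b 2

/-- Euclidean norm on `ℝ³`. -/
noncomputable def len (a : Fin 3 → ℝ) : ℝ := √(dot a a)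

theorem dot_self_nonneg (a : Fin 3 → ℝ) : 0 ≤ dot a a := by
  simp only [dot]; nlinarith [sq_nonneg (a 0), sq_nonneg (a 1), sq_nonneg (a 2)]

theorem dot_self_pos {a : Fin 3 → ℝ} (h : a ≠ 0) : 0 < dot a a := by
  refine lt_of_le_of_ne (dot_self_nonneg a) fun h0 => h ?_
  simp only [dot] at h0
  ext i
  fin_cases i <;> simp <;> nlinarith [sq_nonneg (a 0), sq_nonneg (a 1), sq_nonneg (a 2)]

theorem len_pos {a : Fin 3 → ℝ} (h : a ≠ 0) : 0 < len a := Real.sqrt_pos.2 (dot_self_pos h)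

theorem len_sq (a : Fin 3 → ℝ) : len a ^ 2 = dot a a := Real.sq_sqrt (dot_self_nonneg a)

/-- The squared norms of the two halves of `x`. -/
def sqz (x : R8) : ℝ := x 0 ^ 2 + x 1 ^ 2 + x 4 ^ 2 + x 5 ^ 2
/-- See `sqz`. -/
def sqw (x : R8) : ℝ := x 2 ^ 2 + x 3 ^ 2 + x 6 ^ 2 + x 7 ^ 2

theorem len_Q_fst (x : R8) : len (Q x).1 = sqz x := by
  have h : dot (Q x).1 (Q x).1 = sqz x ^ 2 := by simp [dot, Q, sqz]; ring
  rw [len, h, Real.sqrt_sq (by unfold sqz; positivity)]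

theorem len_Q_snd (x : R8) : len (Q x).2 = sqw x := by
  have h : dot (Q x).2 (Q x).2 = sqw x ^ 2 := by simp [dot, Q, sqw]; ring
  rw [len, h, Real.sqrt_sq (by unfold sqw; positivity)]

theorem R_eq_add (x : R8) : R x = sqz x + sqw x := by
  simp only [R, Fin.sum_univ_eight, sqz, sqw]; ring

theorem sqz_pos {x : R8} (h : Q x ∈ smoothLocus) : 0 < sqz x := by
  rw [← len_Q_fst]; exact len_pos h.1

theorem sqw_pos {x : R8} (h : Q x ∈ smoothLocus) : 0 < sqw x := by
  rw [← len_Q_snd]; exact len_pos h.2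

theorem R_pos {x : R8} (h : Q x ∈ smoothLocus) : 0 < R x := by
  rw [R_eq_add]; exact add_pos (sqz_pos h) (sqw_pos h)

/-- The first coordinate of a section of the Hopf map away from the negative axis. -/
noncomputable def hopfRoot (U : Fin 3 → ℝ) : ℝ := √((len U + U 0) / 2)

theorem hopfRoot_pos {U : Fin 3 → ℝ} (h : 0 < len U + U 0) : 0 < hopfRoot U :=
  Real.sqrt_pos.2 (by positivity)

theorem hopfRoot_section {U : Fin 3 → ℝ} (h : 0 < len U + U 0) :
    hopfRoot U ^ 2 - (U 1 / (2 * hopfRoot U)) ^ 2 - (U 2 / (2 * hopfRoot U)) ^ 2 = U 0 := by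
  have hl := len_sq U
  simp only [dot] at hl
  have hp2 : hopfRoot U ^ 2 = (len U + U 0) / 2 := Real.sq_sqrt (by positivity)
  have : (U 1 / (2 * hopfRoot U)) ^ 2 + (U 2 / (2 * hopfRoot U)) ^ 2 = (len U - U 0) / 2 := by
    rw [div_pow, div_pow, mul_pow, hp2]
    field_simp
    nlinarith
  linarith

theorem exists_hopf (U : Fin 3 → ℝ) : ∃ p q r s : ℝ,
    p ^ 2 + q ^ 2 - r ^ 2 - s ^ 2 = U 0 ∧ 2 * (p * r + q * s) = U 1 ∧
      2 * (p * s - q * r) = U 2 := by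
  have hl := len_sq U
  have hn : 0 ≤ len U := Real.sqrt_nonneg _
  simp only [dot] at hl
  -- The section with real first coordinate `hopfRoot U` breaks down exactly on the closed negative
  -- axis, which is treated by hand.
  by_cases h : len U + U 0 = 0
  · have h0 : U 0 = - len U := by linarith
    rw [h0] at hl
    refine ⟨0, 0, √(len U), 0, ?_, ?_, ?_⟩
    · rw [Real.sq_sqrt hn]; linarith
    · have : U 1 = 0 := by nlinarith [sq_nonneg (U 1), sq_nonneg (U 2)]
      simp [this]
    · have : U 2 = 0 := by nlinarith [sq_nonneg (U 1), sq_nonneg (U 2)]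
      simp [this]
  · have hp : 0 < len U + U 0 := by
      refine lt_of_le_of_ne ?_ (Ne.symm h)
      have := abs_le_of_sq_le_sq' (a := U 0) (b := len U)
        (by nlinarith [sq_nonneg (U 1), sq_nonneg (U 2)]) hn
      linarith [this.1]
    have hp0 := (hopfRoot_pos hp).ne'
    refine ⟨hopfRoot U, 0, U 1 / (2 * hopfRoot U), U 2 / (2 * hopfRoot U), ?_, ?_, ?_⟩
    · linarith [hopfRoot_section hp]
    · field_simp; ring
    · field_simp; ring

theorem Q_surjective : Function.Surjective Q := by
  rintro ⟨U, V⟩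
  obtain ⟨p, q, r, s, h1, h2, h3⟩ := exists_hopf U
  obtain ⟨p', q', r', s', k1, k2, k3⟩ := exists_hopf V
  refine ⟨![p, q, p', q', r, s, r', s'], ?_⟩
  ext i <;> fin_cases i <;> simp [Q, *]

/-! ### Kernel of dQ and torus orbits -/

/-- A horizontal lift of `W` at `x`. -/
noncomputable def lift (x : R8) (W : R6) : R8 :=
  ![(x 0 * W.1 0 + x 4 * W.1 1 + x 5 * W.1 2) / (2 * sqz x),
    (x 1 * W.1 0 + x 5 * W.1 1 - x 4 * W.1 2) / (2 * sqz x),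
    (x 2 * W.2 0 + x 6 * W.2 1 + x 7 * W.2 2) / (2 * sqw x),
    (x 3 * W.2 0 + x 7 * W.2 1 - x 6 * W.2 2) / (2 * sqw x),
    (-x 4 * W.1 0 + x 0 * W.1 1 - x 1 * W.1 2) / (2 * sqz x),
    (-x 5 * W.1 0 + x 1 * W.1 1 + x 0 * W.1 2) / (2 * sqz x),
    (-x 6 * W.2 0 + x 2 * W.2 1 - x 3 * W.2 2) / (2 * sqw x),
    (-x 7 * W.2 0 + x 3 * W.2 1 + x 2 * W.2 2) / (2 * sqw x)]

/-- On each half the differential of the Hopf map times its transpose is 4|z|² times the identity,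
and `lift` is the transpose divided by that factor. -/
theorem fderiv_Q_lift {x : R8} (hx : Q x ∈ smoothLocus) (W : R6) : fderiv ℝ Q x (lift x W) = W := by
  have hz := (sqz_pos hx).ne'
  have hw := (sqw_pos hx).ne'
  rw [fderiv_Q_apply]
  ext i <;> fin_cases i <;> simp [lift] <;> field_simp <;> simp only [sqz, sqw] <;> ring

/-- In each half, the three rows of dQ and the rotation vector form an orthogonal frame of ℝ⁴. A
vector killed by the rows is thus a multiple of the rotation, with coefficient σ or τ. -/
theorem mem_ker_fderiv_Q {x a : R8} (hx : Q x ∈ smoothLocus) (ha : fderiv ℝ Q x a = 0) :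
    ∃ s t : ℝ, a = s • X x + t • Y1 x := by
  have hz := (sqz_pos hx).ne'
  have hw := (sqw_pos hx).ne'
  rw [fderiv_Q_apply, Prod.ext_iff] at ha
  obtain ⟨h1, h2⟩ := ha
  have e0 := congrFun h1 0
  have e1 := congrFun h1 1
  have e2 := congrFun h1 2
  have f0 := congrFun h2 0
  have f1 := congrFun h2 1
  have f2 := congrFun h2 2
  simp at e0 e1 e2 f0 f1 f2
  set σ := (-x 1 * a 0 + x 0 * a 1 - x 5 * a 4 + x 4 * a 5) / sqz x with hσ
  set τ := (-x 3 * a 2 + x 2 * a 3 - x 7 * a 6 + x 6 * a 7) / sqw x with hτ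
  have hσ' : σ * sqz x = -x 1 * a 0 + x 0 * a 1 - x 5 * a 4 + x 4 * a 5 := div_mul_cancel₀ _ hz
  have hτ' : τ * sqw x = -x 3 * a 2 + x 2 * a 3 - x 7 * a 6 + x 6 * a 7 := div_mul_cancel₀ _ hw
  have g0 : a 0 = -σ * x 1 := by
    refine mul_left_cancel₀ hz ?_
    have : sqz x * (-σ * x 1) = -x 1 * (σ * sqz x) := by ring
    rw [this, hσ']; simp only [sqz]
    linear_combination x 0 * e0 + x 4 * e1 + x 5 * e2
  have g1 : a 1 = σ * x 0 := by
    refine mul_left_cancel₀ hz ?_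
    have : sqz x * (σ * x 0) = x 0 * (σ * sqz x) := by ring
    rw [this, hσ']; simp only [sqz]
    linear_combination x 1 * e0 + x 5 * e1 - x 4 * e2
  have g4 : a 4 = -σ * x 5 := by
    refine mul_left_cancel₀ hz ?_
    have : sqz x * (-σ * x 5) = -x 5 * (σ * sqz x) := by ring
    rw [this, hσ']; simp only [sqz]
    linear_combination -x 4 * e0 + x 0 * e1 - x 1 * e2
  have g5 : a 5 = σ * x 4 := by
    refine mul_left_cancel₀ hz ?_
    have : sqz x * (σ * x 4) = x 4 * (σ * sqz x) := by ring
    rw [this, hσ']; simp only [sqz]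
    linear_combination -x 5 * e0 + x 1 * e1 + x 0 * e2
  have g2 : a 2 = -τ * x 3 := by
    refine mul_left_cancel₀ hw ?_
    have : sqw x * (-τ * x 3) = -x 3 * (τ * sqw x) := by ring
    rw [this, hτ']; simp only [sqw]
    linear_combination x 2 * f0 + x 6 * f1 + x 7 * f2
  have g3 : a 3 = τ * x 2 := by
    refine mul_left_cancel₀ hw ?_
    have : sqw x * (τ * x 2) = x 2 * (τ * sqw x) := by ring
    rw [this, hτ']; simp only [sqw]
    linear_combination x 3 * f0 + x 7 * f1 - x 6 * f2
  have g6 : a 6 = -τ * x 7 := by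
    refine mul_left_cancel₀ hw ?_
    have : sqw x * (-τ * x 7) = -x 7 * (τ * sqw x) := by ring
    rw [this, hτ']; simp only [sqw]
    linear_combination -x 6 * f0 + x 2 * f1 - x 3 * f2
  have g7 : a 7 = τ * x 6 := by
    refine mul_left_cancel₀ hw ?_
    have : sqw x * (τ * x 6) = x 6 * (τ * sqw x) := by ring
    rw [this, hτ']; simp only [sqw]
    linear_combination -x 7 * f0 + x 3 * f1 + x 2 * f2
  -- (X + Y₁)/2 rotates only the first half and (X − Y₁)/2 only the second.
  refine ⟨(σ + τ) / 2, (σ - τ) / 2, ?_⟩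
  clear_value σ τ
  ext i
  fin_cases i <;> simp [X, Y1] <;>
    [rw [g0]; rw [g1]; rw [g2]; rw [g3]; rw [g4]; rw [g5]; rw [g6]; rw [g7]] <;>
    ring

/-- The action of the torus on `ℝ⁸`. -/
noncomputable def torus (c s c' s' : ℝ) : R8 →L[ℝ] R8 := LinearMap.toContinuousLinearMap
  { toFun := fun x => ![c * x 0 - s * x 1, s * x 0 + c * x 1, c' * x 2 - s' * x 3,
      s' * x 2 + c' * x 3, c * x 4 - s * x 5, s * x 4 + c * x 5, c' * x 6 - s' * x 7,
      s' * x 6 + c' * x 7]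
    map_add' := fun a b => by ext i; fin_cases i <;> simp <;> ring
    map_smul' := fun a b => by ext i; fin_cases i <;> simp <;> ring }

theorem torus_apply (c s c' s' : ℝ) (x : R8) : torus c s c' s' x =
    ![c * x 0 - s * x 1, s * x 0 + c * x 1, c' * x 2 - s' * x 3,
      s' * x 2 + c' * x 3, c * x 4 - s * x 5, s * x 4 + c * x 5, c' * x 6 - s' * x 7,
      s' * x 6 + c' * x 7] := rfl

section Torus

variable {c s c' s' : ℝ} (h : c ^ 2 + s ^ 2 = 1) (h' : c' ^ 2 + s' ^ 2 = 1)
include h h'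

theorem Q_torus (x : R8) : Q (torus c s c' s' x) = Q x := by
  ext i <;> fin_cases i <;> simp [Q, torus_apply]
  · linear_combination (x 0 ^ 2 + x 1 ^ 2 - x 4 ^ 2 - x 5 ^ 2) * h
  · linear_combination (x 0 * x 4 + x 1 * x 5) * h
  · linear_combination (x 0 * x 5 - x 1 * x 4) * h
  · linear_combination (x 2 ^ 2 + x 3 ^ 2 - x 6 ^ 2 - x 7 ^ 2) * h'
  · linear_combination (x 2 * x 6 + x 3 * x 7) * h'
  · linear_combination (x 2 * x 7 - x 3 * x 6) * h'

theorem fderiv_Q_torus (x a : R8) :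
    fderiv ℝ Q (torus c s c' s' x) (torus c s c' s' a) = fderiv ℝ Q x a := by
  have e : Q ∘ torus c s c' s' = Q := funext (Q_torus h h')
  have := fderiv_comp (𝕜 := ℝ) x (g := Q) (f := torus c s c' s')
    (contDiff_Q.differentiable (by simp)).differentiableAt
    (torus c s c' s').differentiableAt
  rw [e, ContinuousLinearMap.fderiv] at this
  rw [this]; rfl

theorem eucl_torus (x a : R8) :
    eucl (torus c s c' s' x) (torus c s c' s' a) = eucl x a := by
  simp only [eucl_apply, torus_apply]
  simp
  linear_combination (x 0 * a 0 + x 1 * a 1 + x 4 * a 4 + x 5 * a 5) * h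
    + (x 2 * a 2 + x 3 * a 3 + x 6 * a 6 + x 7 * a 7) * h'

theorem R_torus (x : R8) : R (torus c s c' s' x) = R x := by
  rw [R_eq, R_eq, eucl_torus h h']

theorem alpha1_torus (x a : R8) :
    alpha1 (torus c s c' s' x) (torus c s c' s' a) = alpha1 x a := by
  simp only [alpha1_apply, torus_apply]
  simp
  linear_combination (-x 1 * a 0 + x 0 * a 1 - x 5 * a 4 + x 4 * a 5) * h
    + (x 3 * a 2 - x 2 * a 3 + x 7 * a 6 - x 6 * a 7) * h'

-- The torus turns the pair (α₂, α₃) by the difference of its two angles; only rotation-invariant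
-- combinations, such as α₂² + α₃² and α₂ ∧ α₃, are preserved.
omit h h' in
theorem alpha2_torus (x a : R8) : alpha2 (torus c s c' s' x) (torus c s c' s' a) =
    (c * c' + s * s') * alpha2 x a + (s * c' - c * s') * alpha3 x a := by
  simp only [alpha2_apply, alpha3_apply, torus_apply]
  simp
  ring

omit h h' in
theorem alpha3_torus (x a : R8) : alpha3 (torus c s c' s' x) (torus c s c' s' a) =
    (c * c' + s * s') * alpha3 x a - (s * c' - c * s') * alpha2 x a := by
  simp only [alpha2_apply, alpha3_apply, torus_apply]
  simp
  ring

omit h h' in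
theorem X_torus (x : R8) : X (torus c s c' s' x) = torus c s c' s' (X x) := by
  ext i
  fin_cases i <;> simp [X, torus_apply] <;> ring

end Torus

theorem exists_torus {x y : R8} (hx : Q x ∈ smoothLocus) (h : Q y = Q x) :
    ∃ c s c' s' : ℝ, c ^ 2 + s ^ 2 = 1 ∧ c' ^ 2 + s' ^ 2 = 1 ∧ y = torus c s c' s' x := by
  have hz := (sqz_pos hx).ne'
  have hw := (sqw_pos hx).ne'
  have nz : sqz y = sqz x := by rw [← len_Q_fst, h, len_Q_fst]
  have nw : sqw y = sqw x := by rw [← len_Q_snd, h, len_Q_snd]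
  rw [Prod.ext_iff] at h
  obtain ⟨h1, h2⟩ := h
  have e0 := congrFun h1 0
  have e1 := congrFun h1 1
  have e2 := congrFun h1 2
  have f0 := congrFun h2 0
  have f1 := congrFun h2 1
  have f2 := congrFun h2 2
  simp [Q] at e0 e1 e2 f0 f1 f2
  have key : ∀ p q r t p' q' r' t' n : ℝ, n ≠ 0 → p ^ 2 + q ^ 2 + r ^ 2 + t ^ 2 = n →
      p' ^ 2 + q' ^ 2 + r' ^ 2 + t' ^ 2 = n →
      p' ^ 2 + q' ^ 2 - r' ^ 2 - t' ^ 2 = p ^ 2 + q ^ 2 - r ^ 2 - t ^ 2 →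
      p' * r' + q' * t' = p * r + q * t → p' * t' - q' * r' = p * t - q * r →
      ∃ c s, c ^ 2 + s ^ 2 = 1 ∧ p' = c * p - s * q ∧ q' = s * p + c * q ∧
        r' = c * r - s * t ∧ t' = s * r + c * t := by
    intro p q r t p' q' r' t' n hn k0 k1 k2 k3 k4
    have a1 : p' ^ 2 + q' ^ 2 = p ^ 2 + q ^ 2 := by linarith
    have a2 : r' ^ 2 + t' ^ 2 = r ^ 2 + t ^ 2 := by linarith
    -- In complex notation c + is is the Hermitian product of (p + iq, r + it) with (p' + iq', r' +
    -- it'), divided by the common squared norm n.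
    set c := (p * p' + q * q' + r * r' + t * t') / n with hc
    set s := (p * q' - q * p' + r * t' - t * r') / n with hs
    have hc' : c * n = p * p' + q * q' + r * r' + t * t' := div_mul_cancel₀ _ hn
    have hs' : s * n = p * q' - q * p' + r * t' - t * r' := div_mul_cancel₀ _ hn
    clear_value c s
    have b1 : p' = c * p - s * q := by
      refine mul_right_cancel₀ hn ?_
      have : (c * p - s * q) * n = p * (c * n) - q * (s * n) := by ring
      rw [this, hc', hs', ← k1]
      linear_combination p' * a1 + r' * k3 + t' * k4
    have b2 : q' = s * p + c * q := by
      refine mul_right_cancel₀ hn ?_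
      have : (s * p + c * q) * n = p * (s * n) + q * (c * n) := by ring
      rw [this, hc', hs', ← k1]
      linear_combination q' * a1 + t' * k3 - r' * k4
    have b3 : r' = c * r - s * t := by
      refine mul_right_cancel₀ hn ?_
      have : (c * r - s * t) * n = r * (c * n) - t * (s * n) := by ring
      rw [this, hc', hs', ← k1]
      linear_combination r' * a2 + p' * k3 - q' * k4
    have b4 : t' = s * r + c * t := by
      refine mul_right_cancel₀ hn ?_
      have : (s * r + c * t) * n = r * (s * n) + t * (c * n) := by ring
      rw [this, hc', hs', ← k1]
      linear_combination t' * a2 + q' * k3 + p' * k4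
    refine ⟨c, s, ?_, b1, b2, b3, b4⟩
    refine mul_right_cancel₀ hn ?_
    have : (c ^ 2 + s ^ 2) * n = p' ^ 2 + q' ^ 2 + r' ^ 2 + t' ^ 2 := by
      rw [← k0, b1, b2, b3, b4]; ring
    rw [this, k1, one_mul]
  obtain ⟨c, s, g, g0, g1, g4, g5⟩ := key (x 0) (x 1) (x 4) (x 5) (y 0) (y 1) (y 4) (y 5) (sqz x)
    hz rfl nz e0 e1 e2
  obtain ⟨c', s', g', g2, g3, g6, g7⟩ := key (x 2) (x 3) (x 6) (x 7) (y 2) (y 3) (y 6) (y 7) (sqw x)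
    hw rfl nw f0 f1 f2
  refine ⟨c, s, c', s', g, g', ?_⟩
  ext i
  fin_cases i <;> simp [torus_apply] <;> assumption

/-! ### Descent of tensors along the quotient map -/

/-- The slots are exchanged one at a time, each change costing a value of η with an argument in K.
-/
theorem alternating_congr {E : Type*} [NormedAddCommGroup E] [NormedSpace ℝ E] {k : ℕ}
    (η : E [⋀^Fin k]→L[ℝ] ℝ) (K : E → Prop) (hK : ∀ (v : Fin k → E) (i : Fin k), K (v i) → η v = 0)
    {v w : Fin k → E} (h : ∀ i, K (v i - w i)) : η v = η w := by
  classical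
  have key : ∀ s : Finset (Fin k), η (s.piecewise v w) = η w := by
    intro s
    induction s using Finset.induction_on with
    | empty => simp
    | insert i s hi ih =>
      rw [Finset.piecewise_insert, ← ih]
      have e : s.piecewise v w = Function.update (s.piecewise v w) i (w i) := by
        rw [Function.eq_update_self_iff]; simp [hi]
      have := η.map_update_sub (s.piecewise v w) i (v i) (w i)
      rw [hK _ i (by simpa using h i)] at this
      rw [← e] at this
      linarith
  simpa using key Finset.univ

theorem fderiv_Q_surjective {x : R8} (hx : Q x ∈ smoothLocus) :
    Function.Surjective (fderiv ℝ Q x) := fun W => ⟨lift x W, fderiv_Q_lift hx W⟩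

theorem torus_inv {c s c' s' : ℝ} (h : c ^ 2 + s ^ 2 = 1) (h' : c' ^ 2 + s' ^ 2 = 1) (a : R8) :
    torus c s c' s' (torus c (-s) c' (-s') a) = a := by
  ext i
  fin_cases i <;> simp [torus_apply]
  · linear_combination a 0 * h
  · linear_combination a 1 * h
  · linear_combination a 2 * h'
  · linear_combination a 3 * h'
  · linear_combination a 4 * h
  · linear_combination a 5 * h
  · linear_combination a 6 * h'
  · linear_combination a 7 * h'

theorem exists_lift {x : R8} (hx : Q x ∈ smoothLocus) :
    ∃ L : R6 →L[ℝ] R8, ∀ W, fderiv ℝ Q x (L W) = W := by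
  obtain ⟨g, hg⟩ := LinearMap.exists_rightInverse_of_surjective
    (fderiv ℝ Q x : R8 →ₗ[ℝ] R6) (LinearMap.range_eq_top.2 (fderiv_Q_surjective hx))
  exact ⟨LinearMap.toContinuousLinearMap g, fun W => LinearMap.congr_fun hg W⟩

/-- At one point of the fibre the form is pushed down along a linear right inverse of dQ. Vanishing
on ker dQ makes the choice immaterial, and torus invariance carries the identity to the other points
of the fibre. -/
theorem existsUnique_pushdownForm {k : ℕ} {η : R8 → R8 [⋀^Fin k]→L[ℝ] ℝ}
    (hX : ∀ x, Q x ∈ smoothLocus → ∀ v i, v i = X x → η x v = 0)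
    (hY : ∀ x, Q x ∈ smoothLocus → ∀ v i, v i = Y1 x → η x v = 0)
    (hT : ∀ x, Q x ∈ smoothLocus → ∀ c s c' s' : ℝ, c ^ 2 + s ^ 2 = 1 → c' ^ 2 + s' ^ 2 = 1 →
      ∀ v, η (torus c s c' s' x) (fun i => torus c s c' s' (v i)) = η x v)
    {m : R6} (hm : m ∈ smoothLocus) : ∃! β, IsPushdownForm η m β := by
  classical
  obtain ⟨x, rfl⟩ := Q_surjective m
  obtain ⟨L, hL⟩ := exists_lift hm
  have hK : ∀ (v : Fin k → R8) i, fderiv ℝ Q x (v i) = 0 → η x v = 0 := by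
    intro v i hv
    obtain ⟨s, t, hst⟩ := mem_ker_fderiv_Q hm hv
    have e : v = Function.update v i (s • X x + t • Y1 x) := by
      rw [← hst, Function.update_eq_self]
    rw [e, ContinuousAlternatingMap.map_update_add, ContinuousAlternatingMap.map_update_smul,
      ContinuousAlternatingMap.map_update_smul, hX x hm _ i (by simp), hY x hm _ i (by simp)]
    simp
  refine ⟨(η x).compContinuousLinearMap L, ?_, ?_⟩
  · intro y hy
    obtain ⟨c, s, c', s', h, h', rfl⟩ := exists_torus hm hy
    ext v
    have e : v = fun i => torus c s c' s' (torus c (-s) c' (-s') (v i)) :=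
      funext fun i => (torus_inv h h' (v i)).symm
    rw [e, hT x hm c s c' s' h h']
    simp only [ContinuousAlternatingMap.compContinuousLinearMap_apply, Function.comp_def,
      fderiv_Q_torus h h']
    refine alternating_congr (η x) (fun a => fderiv ℝ Q x a = 0) hK fun i => ?_
    rw [map_sub, hL, sub_self]
  · intro β hβ
    have := hβ x rfl
    rw [← this]
    ext v
    simp [Function.comp_def, hL]

theorem existsUnique_pushdownBilin {T : R8 → R8 →L[ℝ] R8 →L[ℝ] ℝ}
    (hX : ∀ x, Q x ∈ smoothLocus → ∀ v, T x (X x) v = 0 ∧ T x v (X x) = 0)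
    (hY : ∀ x, Q x ∈ smoothLocus → ∀ v, T x (Y1 x) v = 0 ∧ T x v (Y1 x) = 0)
    (hT : ∀ x, Q x ∈ smoothLocus → ∀ c s c' s' : ℝ, c ^ 2 + s ^ 2 = 1 → c' ^ 2 + s' ^ 2 = 1 →
      ∀ v w, T (torus c s c' s' x) (torus c s c' s' v) (torus c s c' s' w) = T x v w)
    {m : R6} (hm : m ∈ smoothLocus) : ∃! b, IsPushdownBilin T m b := by
  obtain ⟨x, rfl⟩ := Q_surjective m
  obtain ⟨L, hL⟩ := exists_lift hm
  have hK1 : ∀ v w v', fderiv ℝ Q x v = fderiv ℝ Q x v' → T x v w = T x v' w := by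
    intro v w v' h
    obtain ⟨s, t, hst⟩ := mem_ker_fderiv_Q hm (a := v - v') (by rw [map_sub, h, sub_self])
    have : T x (v - v') w = 0 := by rw [hst]; simp [hX x hm w, hY x hm w]
    rw [map_sub, sub_apply] at this
    linarith
  have hK2 : ∀ v w w', fderiv ℝ Q x w = fderiv ℝ Q x w' → T x v w = T x v w' := by
    intro v w v' h
    obtain ⟨s, t, hst⟩ := mem_ker_fderiv_Q hm (a := w - v') (by rw [map_sub, h, sub_self])
    have : T x v (w - v') = 0 := by rw [hst]; simp [hX x hm v, hY x hm v]
    rw [map_sub] at this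
    linarith
  refine ⟨(T x).bilinearComp L L, ?_, ?_⟩
  · intro y hy v w
    obtain ⟨c, s, c', s', h, h', rfl⟩ := exists_torus hm hy
    rw [← torus_inv h h' v, ← torus_inv h h' w, hT x hm c s c' s' h h', fderiv_Q_torus h h',
      fderiv_Q_torus h h', ContinuousLinearMap.bilinearComp_apply]
    rw [hK1 _ _ _ (hL _), hK2 _ _ _ (hL _)]
  · intro β hβ
    have := hβ x rfl
    refine ContinuousLinearMap.ext fun V => ContinuousLinearMap.ext fun W => ?_
    rw [ContinuousLinearMap.bilinearComp_apply, ← this, hL, hL]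

/-! ### The tensors on `ℝ⁸` -/

theorem eucl_Y1 (x : R8) : eucl x (Y1 x) = 0 := by simp [eucl_apply, Y1]; ring
theorem alpha1_Y1 (x : R8) : alpha1 x (Y1 x) = R x := by
  simp [alpha1_apply, Y1, R, Fin.sum_univ_eight]; ring
theorem alpha2_Y1 (x : R8) : alpha2 x (Y1 x) = 0 := by simp [alpha2_apply, Y1]; ring
theorem alpha3_Y1 (x : R8) : alpha3 x (Y1 x) = 0 := by simp [alpha3_apply, Y1]; ring
theorem eucl_X (x : R8) : eucl x (X x) = 0 := by simp [eucl_apply, X]; ring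
theorem eucl_Y1_left (x c : R8) : eucl (Y1 x) c = alpha1 x c := rfl
theorem alpha1_Y1_left (x c : R8) : alpha1 (Y1 x) c = -eucl x c := by
  simp [alpha1_apply, eucl_apply, Y1]; ring
theorem alpha2_Y1_left (x c : R8) : alpha2 (Y1 x) c = alpha3 x c := by
  simp [alpha2_apply, alpha3_apply, Y1]; ring
theorem alpha3_Y1_left (x c : R8) : alpha3 (Y1 x) c = -alpha2 x c := by
  simp [alpha2_apply, alpha3_apply, Y1]; ring

theorem h2_comm {x : R8} (hx : R x ≠ 0) (a b : R8) : h2 x a b = h2 x b a := by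
  rw [h2_apply hx, h2_apply hx, eucl_comm a b]; ring

theorem h2_Y1 {x : R8} (hx : R x ≠ 0) (a : R8) : h2 x (Y1 x) a = 0 := by
  rw [h2_apply hx, eucl_Y1, alpha1_Y1, alpha2_Y1, alpha3_Y1, eucl_Y1_left]; ring

theorem normSqX_eq {x : R8} (hx : R x ≠ 0) :
    normSqX x = 6 * sqz x * sqw x - 2 * dot (Q x).1 (Q x).2 := by
  rw [normSqX, h2_apply hx, eucl_X, R_eq_add]
  simp only [alpha1_apply, alpha2_apply, alpha3_apply, eucl_apply, X, dot, Q, sqz, sqw]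
  simp
  ring

theorem dot_le (a b : Fin 3 → ℝ) : dot a b ≤ len a * len b := by
  refine (abs_le_of_sq_le_sq' ?_ (mul_nonneg (Real.sqrt_nonneg _) (Real.sqrt_nonneg _))).2
  change _ ≤ (len a * len b) ^ 2
  rw [mul_pow, len_sq, len_sq]
  simp only [dot]
  nlinarith [sq_nonneg (a 0 * b 1 - a 1 * b 0), sq_nonneg (a 0 * b 2 - a 2 * b 0),
    sq_nonneg (a 1 * b 2 - a 2 * b 1)]

/-- By Cauchy–Schwarz, N ≥ 4|𝐮||𝐯|. -/
theorem normSqX_pos {x : R8} (hx : Q x ∈ smoothLocus) : 0 < normSqX x := by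
  rw [normSqX_eq (R_pos hx).ne']
  have := dot_le (Q x).1 (Q x).2
  rw [len_Q_fst, len_Q_snd] at this
  nlinarith [mul_pos (sqz_pos hx) (sqw_pos hx)]

theorem theta_apply (x a : R8) : theta x a = (normSqX x)⁻¹ * h2 x (X x) a := by
  simp [theta]

theorem theta_X {x : R8} (hx : Q x ∈ smoothLocus) : theta x (X x) = 1 := by
  rw [theta_apply, ← normSqX, inv_mul_cancel₀ (normSqX_pos hx).ne']

theorem theta_Y1 {x : R8} (hx : Q x ∈ smoothLocus) : theta x (Y1 x) = 0 := by
  rw [theta_apply, h2_comm (R_pos hx).ne', h2_Y1 (R_pos hx).ne', mul_zero]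

theorem horizontalMetric_apply (x a b : R8) :
    horizontalMetric x a b = h2 x a b - normSqX x * (theta x a * theta x b) := by
  simp [horizontalMetric, tensor]

theorem vec2_eta {α : Type*} (v : Fin 2 → α) : v = ![v 0, v 1] := by
  ext i; fin_cases i <;> rfl

theorem vec3_eta {α : Type*} (v : Fin 3 → α) : v = ![v 0, v 1, v 2] := by
  ext i; fin_cases i <;> rfl

theorem contractedForm_apply (x a b : R8) : contractedForm x ![a, b] = phi x ![X x, a, b] := rfl

theorem psiMinusUp_apply (x a b c : R8) : psiMinusUp x ![a, b, c] = normSqX x ^ (3 / 4 : ℝ) *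
    (phi x ![a, b, c] - (theta x a * phi x ![X x, b, c] - theta x b * phi x ![X x, a, c]
      + theta x c * phi x ![X x, a, b])) := by
  simp [psiMinusUp, wedge_two_apply, contractedForm_apply]

theorem phi_self_left (x a b : R8) : phi x ![a, a, b] = 0 :=
  (phi x).map_eq_zero_of_eq _ (i := 0) (j := 1) rfl (by decide)

theorem phi_self_outer (x a b : R8) : phi x ![a, b, a] = 0 :=
  (phi x).map_eq_zero_of_eq _ (i := 0) (j := 2) rfl (by decide)

theorem phi_swap_left {x : R8} (hx : R x ≠ 0) (a b c : R8) :
    phi x ![b, a, c] = -phi x ![a, b, c] := by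
  rw [phi_apply hx, phi_apply hx, (alpha_antisymm a b).1, (alpha_antisymm a b).2.1,
    (alpha_antisymm a b).2.2]
  ring

theorem phi_swap_right {x : R8} (hx : R x ≠ 0) (a b c : R8) :
    phi x ![a, c, b] = -phi x ![a, b, c] := by
  rw [phi_apply hx, phi_apply hx, (alpha_antisymm b c).1, (alpha_antisymm b c).2.1,
    (alpha_antisymm b c).2.2]
  ring

theorem phi_Y1 {x : R8} (hx : R x ≠ 0) (b c : R8) : phi x ![Y1 x, b, c] = 0 := by
  rw [phi_apply hx]
  simp only [eucl_Y1, alpha1_Y1_left, alpha2_Y1, alpha3_Y1, alpha2_Y1_left, alpha3_Y1_left]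
  ring

theorem phi_Y1_mid {x : R8} (hx : R x ≠ 0) (b c : R8) : phi x ![b, Y1 x, c] = 0 := by
  rw [phi_swap_left hx, phi_Y1 hx, neg_zero]

theorem phi_Y1_right {x : R8} (hx : R x ≠ 0) (b c : R8) : phi x ![b, c, Y1 x] = 0 := by
  rw [phi_swap_right hx, phi_Y1_mid hx, neg_zero]

section Torus

variable {c s c' s' : ℝ} (h : c ^ 2 + s ^ 2 = 1) (h' : c' ^ 2 + s' ^ 2 = 1)
include h h'

theorem h2_torus {x : R8} (hx : R x ≠ 0) (a b : R8) :
    h2 (torus c s c' s' x) (torus c s c' s' a) (torus c s c' s' b) = h2 x a b := by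
  -- cos² + sin² = 1 for the difference of the two angles, by which (α₂, α₃) is turned.
  have hC : (c * c' + s * s') ^ 2 + (s * c' - c * s') ^ 2 = 1 := by
    linear_combination (c' ^ 2 + s' ^ 2) * h + h'
  rw [h2_apply hx, h2_apply (by rwa [R_torus h h']), R_torus h h']
  simp only [eucl_torus h h', alpha1_torus h h', alpha2_torus, alpha3_torus]
  linear_combination -(alpha2 x a * alpha2 x b + alpha3 x a * alpha3 x b) * hC

theorem phi_torus {x : R8} (hx : R x ≠ 0) (a b d : R8) :
    phi (torus c s c' s' x) ![torus c s c' s' a, torus c s c' s' b, torus c s c' s' d]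
      = phi x ![a, b, d] := by
  have hC : (c * c' + s * s') ^ 2 + (s * c' - c * s') ^ 2 = 1 := by
    linear_combination (c' ^ 2 + s' ^ 2) * h + h'
  rw [phi_apply hx, phi_apply (by rwa [R_torus h h']), R_torus h h']
  simp only [eucl_torus h h', alpha1_torus h h', alpha2_torus, alpha3_torus]
  generalize c * c' + s * s' = C at hC ⊢
  generalize s * c' - c * s' = S at hC ⊢
  linear_combination (2 * (eucl x a * (alpha2 x b * alpha3 x d - alpha2 x d * alpha3 x b)
      - eucl x b * (alpha2 x a * alpha3 x d - alpha2 x d * alpha3 x a)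
      + eucl x d * (alpha2 x a * alpha3 x b - alpha2 x b * alpha3 x a))
    + 2 * R x * (alpha2 a b * alpha3 x d - alpha2 a d * alpha3 x b + alpha2 b d * alpha3 x a
      - alpha3 a b * alpha2 x d + alpha3 a d * alpha2 x b - alpha3 b d * alpha2 x a)) * hC

theorem normSqX_torus {x : R8} (hx : R x ≠ 0) : normSqX (torus c s c' s' x) = normSqX x := by
  rw [normSqX, X_torus, h2_torus h h' hx, normSqX]

theorem theta_torus {x : R8} (hx : R x ≠ 0) (a : R8) :
    theta (torus c s c' s' x) (torus c s c' s' a) = theta x a := by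
  rw [theta_apply, theta_apply, X_torus, h2_torus h h' hx, normSqX_torus h h' hx]

end Torus

theorem existsUnique_pushdownFun_normSqX {m : R6} (hm : m ∈ smoothLocus) :
    ∃! c, IsPushdownFun normSqX m c := by
  obtain ⟨x, rfl⟩ := Q_surjective m
  refine ⟨normSqX x, fun y hy => ?_, fun c hc => hc x rfl⟩
  rw [normSqX_eq (R_pos hm).ne', normSqX_eq (R_pos (hy ▸ hm)).ne', ← len_Q_fst, ← len_Q_snd,
    ← len_Q_fst, ← len_Q_snd, hy]

theorem existsUnique_pushdownBilin_horizontalMetric {m : R6} (hm : m ∈ smoothLocus) :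
    ∃! b, IsPushdownBilin horizontalMetric m b := by
  refine existsUnique_pushdownBilin (fun x hx v => ?_) (fun x hx v => ?_)
    (fun x hx c s c' s' h h' v w => ?_) hm
  · have hN := (normSqX_pos hx).ne'
    rw [horizontalMetric_apply, horizontalMetric_apply, theta_X hx, h2_comm (R_pos hx).ne' v,
      theta_apply]
    constructor <;> field_simp <;> ring
  · rw [horizontalMetric_apply, horizontalMetric_apply, theta_Y1 hx, h2_comm (R_pos hx).ne' v,
      h2_Y1 (R_pos hx).ne']
    constructor <;> ring
  · simp only [horizontalMetric_apply, h2_torus h h' (R_pos hx).ne',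
      theta_torus h h' (R_pos hx).ne', normSqX_torus h h' (R_pos hx).ne']

theorem existsUnique_pushdownForm_contractedForm {m : R6} (hm : m ∈ smoothLocus) :
    ∃! β, IsPushdownForm contractedForm m β := by
  refine existsUnique_pushdownForm (fun x hx v i hi => ?_) (fun x hx v i hi => ?_)
    (fun x hx c s c' s' h h' v => ?_) hm
  · have hR := (R_pos hx).ne'
    rw [vec2_eta v, contractedForm_apply]
    fin_cases i <;> simp at hi <;> rw [hi]
    · exact phi_self_left _ _ _
    · exact phi_self_outer _ _ _
  · have hR := (R_pos hx).ne'
    rw [vec2_eta v, contractedForm_apply]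
    fin_cases i <;> simp at hi <;> rw [hi]
    · exact phi_Y1_mid hR _ _
    · exact phi_Y1_right hR _ _
  · rw [vec2_eta v, vec2_eta (fun i => torus c s c' s' _), contractedForm_apply,
      contractedForm_apply, X_torus]
    exact phi_torus h h' (R_pos hx).ne' _ _ _

/-- Contraction with X gives zero because θ(X) = 1 and X ⌟ (X ⌟ φ) = 0; contraction with Y₁ does
because both θ and φ annihilate Y₁. -/
theorem existsUnique_pushdownForm_psiMinusUp {m : R6} (hm : m ∈ smoothLocus) :
    ∃! β, IsPushdownForm psiMinusUp m β := by
  refine existsUnique_pushdownForm (fun x hx v i hi => ?_) (fun x hx v i hi => ?_)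
    (fun x hx c s c' s' h h' v => ?_) hm
  · have hR := (R_pos hx).ne'
    rw [vec3_eta v, psiMinusUp_apply]
    fin_cases i <;> simp at hi <;> rw [hi] <;>
      simp only [theta_X hx, phi_self_left, phi_self_outer]
    · ring
    · rw [phi_swap_left hR]; ring
    · rw [phi_swap_right hR, phi_swap_left hR]; ring
  · have hR := (R_pos hx).ne'
    rw [vec3_eta v, psiMinusUp_apply]
    fin_cases i <;> simp at hi <;> rw [hi] <;>
      simp only [theta_Y1 hx, phi_Y1 hR, phi_Y1_mid hR, phi_Y1_right hR] <;> ring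
  · have hR := (R_pos hx).ne'
    rw [vec3_eta v, vec3_eta (fun i => torus c s c' s' _), psiMinusUp_apply, psiMinusUp_apply,
      X_torus]
    simp only [phi_torus h h' hR, theta_torus h h' hR, normSqX_torus h h' hR]
    rfl

/-- Since the defining predicate is satisfiable, `Classical.epsilon` returns a value that satisfies
it. -/
theorem N_Q {x : R8} (hx : Q x ∈ smoothLocus) : N (Q x) = normSqX x :=
  (Classical.epsilon_spec (existsUnique_pushdownFun_normSqX hx).exists) x rfl

theorem g2_Q {x : R8} (hx : Q x ∈ smoothLocus) (v w : R8) :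
    g2 (Q x) (fderiv ℝ Q x v) (fderiv ℝ Q x w) = horizontalMetric x v w :=
  (Classical.epsilon_spec (existsUnique_pushdownBilin_horizontalMetric hx).exists) x rfl v w

theorem sigma_Q {x : R8} (hx : Q x ∈ smoothLocus) (v w : R8) :
    sigma (Q x) ![fderiv ℝ Q x v, fderiv ℝ Q x w] = phi x ![X x, v, w] := by
  have h := (Classical.epsilon_spec (existsUnique_pushdownForm_contractedForm hx).exists) x rfl
  have h := DFunLike.congr_fun h ![v, w]
  rw [contractedForm_apply] at h
  rw [← h, ContinuousAlternatingMap.compContinuousLinearMap_apply]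
  congr 1
  ext1 i
  fin_cases i <;> rfl

theorem psiMinus_Q {x : R8} (hx : Q x ∈ smoothLocus) :
    (psiMinus (Q x)).compContinuousLinearMap (fderiv ℝ Q x) = psiMinusUp x :=
  (Classical.epsilon_spec (existsUnique_pushdownForm_psiMinusUp hx).exists) x rfl

/-! ### Explicit formulas on the quotient -/

theorem dot_comm (a b : Fin 3 → ℝ) : dot a b = dot b a := by simp only [dot]; ring

theorem dot_Q_fst (x a : R8) : dot (Q x).1 (fderiv ℝ Q x a).1 =
    sqz x * (2 * (x 0 * a 0 + x 1 * a 1 + x 4 * a 4 + x 5 * a 5)) := by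
  rw [fderiv_Q_apply]; simp [dot, Q, sqz]; ring

theorem dot_Q_snd (x a : R8) : dot (Q x).2 (fderiv ℝ Q x a).2 =
    sqw x * (2 * (x 2 * a 2 + x 3 * a 3 + x 6 * a 6 + x 7 * a 7)) := by
  rw [fderiv_Q_apply]; simp [dot, Q, sqw]; ring

theorem sigma_eq {m : R6} (hm : m ∈ smoothLocus) (W Y : R6) : sigma m ![W, Y] =
    -(1 / 2) * (len m.1 + len m.2) *
        (dot m.1 W.1 / len m.1 * (dot m.2 Y.2 / len m.2)
          - dot m.2 W.2 / len m.2 * (dot m.1 Y.1 / len m.1))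
      + 1 / 2 * ((dot m.1 W.1 / len m.1 + dot m.2 W.2 / len m.2) * (dot m.1 Y.2 - dot m.2 Y.1)
          - (dot m.1 Y.1 / len m.1 + dot m.2 Y.2 / len m.2) * (dot m.1 W.2 - dot m.2 W.1))
      + (len m.1 + len m.2) * (dot W.1 Y.2 - dot W.2 Y.1) := by
  obtain ⟨x, rfl⟩ := Q_surjective m
  obtain ⟨a, rfl⟩ := fderiv_Q_surjective hm W
  obtain ⟨b, rfl⟩ := fderiv_Q_surjective hm Y
  rw [sigma_Q hm, dot_Q_fst, dot_Q_fst, dot_Q_snd, dot_Q_snd, len_Q_fst, len_Q_snd,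
    mul_div_cancel_left₀ _ (sqz_pos hm).ne', mul_div_cancel_left₀ _ (sqz_pos hm).ne',
    mul_div_cancel_left₀ _ (sqw_pos hm).ne', mul_div_cancel_left₀ _ (sqw_pos hm).ne',
    phi_apply (R_pos hm).ne', eucl_X, R_eq_add, fderiv_Q_apply, fderiv_Q_apply]
  simp only [eucl_apply, alpha1_apply, alpha2_apply, alpha3_apply, X, dot, Q, sqz, sqw]
  simp
  ring

theorem N_eq {m : R6} (hm : m ∈ smoothLocus) :
    N m = 6 * len m.1 * len m.2 - 2 * dot m.1 m.2 := by
  obtain ⟨x, rfl⟩ := Q_surjective m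
  rw [N_Q hm, normSqX_eq (R_pos hm).ne', len_Q_fst, len_Q_snd]

theorem N_pos {m : R6} (hm : m ∈ smoothLocus) : 0 < N m := by
  obtain ⟨x, rfl⟩ := Q_surjective m
  rw [N_Q hm]
  exact normSqX_pos hm

/-! ### The inverse of g₂ -/

/-- The Euclidean gradient of the pullback to `ℝ⁸` of the covector `(p, q)` on `ℝ⁶`. -/
def cograd (x : R8) (p q : Fin 3 → ℝ) : R8 :=
  ![2 * (x 0 * p 0 + x 4 * p 1 + x 5 * p 2), 2 * (x 1 * p 0 + x 5 * p 1 - x 4 * p 2),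
    2 * (x 2 * q 0 + x 6 * q 1 + x 7 * q 2), 2 * (x 3 * q 0 + x 7 * q 1 - x 6 * q 2),
    2 * (-x 4 * p 0 + x 0 * p 1 - x 1 * p 2), 2 * (-x 5 * p 0 + x 1 * p 1 + x 0 * p 2),
    2 * (-x 6 * q 0 + x 2 * q 1 - x 3 * q 2), 2 * (-x 7 * q 0 + x 3 * q 1 + x 2 * q 2)]

theorem eucl_cograd (x b : R8) (p q : Fin 3 → ℝ) :
    eucl (cograd x p q) b = dot p (fderiv ℝ Q x b).1 + dot q (fderiv ℝ Q x b).2 := by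
  rw [fderiv_Q_apply]
  simp [eucl_apply, cograd, dot]
  ring

/-- The vector dual with respect to `h₂` to the pullback of the covector `(p, q)`. -/
noncomputable def dualVec (x : R8) (p q : Fin 3 → ℝ) : R8 :=
  (2 * R x)⁻¹ • cograd x p q - (eucl x (cograd x p q) / (4 * R x ^ 2)) • x
    + (alpha2 x (cograd x p q) / (2 * R x ^ 2)) • Y2 x
    + (alpha3 x (cograd x p q) / (2 * R x ^ 2)) • Y3 x

/-- Relative to e, h₂ has eigenvalue 4R on x, 0 on Y₁, R on Y₂ and Y₃, and 2R on the rest, which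
dictates the coefficients of `dualVec`. The degenerate direction does no harm: a pulled-back
covector annihilates Y₁ (`e12`). -/
theorem h2_dualVec {x : R8} (hx : R x ≠ 0) (p q : Fin 3 → ℝ) (b : R8) :
    h2 x (dualVec x p q) b = dot p (fderiv ℝ Q x b).1 + dot q (fderiv ℝ Q x b).2 := by
  rw [← eucl_cograd, h2_apply hx]
  have e1 : eucl x (Y2 x) = 0 := by simp [eucl_apply, Y2]; ring
  have e2 : eucl x (Y3 x) = 0 := by simp [eucl_apply, Y3]; ring
  have e3 : alpha1 x x = 0 := by simp [alpha1_apply]; ring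
  have e4 : alpha1 x (Y2 x) = 0 := by simp [alpha1_apply, Y2]; ring
  have e5 : alpha1 x (Y3 x) = 0 := by simp [alpha1_apply, Y3]; ring
  have e6 : alpha2 x x = 0 := by simp [alpha2_apply]; ring
  have e7 : alpha2 x (Y2 x) = R x := by simp [alpha2_apply, Y2, R, Fin.sum_univ_eight]; ring
  have e8 : alpha2 x (Y3 x) = 0 := by simp [alpha2_apply, Y3]; ring
  have e9 : alpha3 x x = 0 := by simp [alpha3_apply]; ring
  have e10 : alpha3 x (Y2 x) = 0 := by simp [alpha3_apply, Y2]; ring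
  have e11 : alpha3 x (Y3 x) = R x := by simp [alpha3_apply, Y3, R, Fin.sum_univ_eight]; ring
  have e12 : alpha1 x (cograd x p q) = 0 := by
    simp [alpha1_apply, cograd]; ring
  have e13 : eucl (Y2 x) b = alpha2 x b := rfl
  have e14 : eucl (Y3 x) b = alpha3 x b := rfl
  simp only [dualVec, map_add, map_sub, map_smul, add_apply, sub_apply, smul_apply, smul_eq_mul,
    e1, e2, e3, e4, e5, e6, e7, e8, e9, e10, e11, e12, e13, e14, ← R_eq]
  field_simp
  ring

theorem fderiv_Q_X (x : R8) : fderiv ℝ Q x (X x) = 0 := by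
  rw [fderiv_Q_apply]
  ext i <;> fin_cases i <;> simp [X] <;> ring

theorem theta_dualVec {x : R8} (hx : R x ≠ 0) (p q : Fin 3 → ℝ) : theta x (dualVec x p q) = 0 := by
  rw [theta_apply, h2_comm hx, h2_dualVec hx, fderiv_Q_X]
  simp [dot]

/-- Since θ vanishes on the dual vector, h₂ and its horizontal part agree there. -/
theorem g2_dualVec {x : R8} (hx : Q x ∈ smoothLocus) (p q : Fin 3 → ℝ) (Y : R6) :
    g2 (Q x) (fderiv ℝ Q x (dualVec x p q)) Y = dot p Y.1 + dot q Y.2 ∧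
    g2 (Q x) Y (fderiv ℝ Q x (dualVec x p q)) = dot p Y.1 + dot q Y.2 := by
  obtain ⟨b, rfl⟩ := fderiv_Q_surjective hx Y
  have hR := (R_pos hx).ne'
  rw [g2_Q hx, g2_Q hx, horizontalMetric_apply, horizontalMetric_apply, theta_dualVec hR,
    h2_comm hR b, h2_dualVec hR]
  constructor <;> ring

theorem g2_nondegenerate {m : R6} (hm : m ∈ smoothLocus) {Z : R6} (h : ∀ Y, g2 m Z Y = 0) :
    Z = 0 := by
  obtain ⟨x, rfl⟩ := Q_surjective m
  -- Pairing Z with the dual of the covector having the same components as Z gives the Euclidean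
  -- |Z|².
  have h1 := h (fderiv ℝ Q x (dualVec x Z.1 Z.2))
  rw [(g2_dualVec hm _ _ _).2] at h1
  have a1 := dot_self_nonneg Z.1
  have a2 := dot_self_nonneg Z.2
  by_contra hZ
  rcases Classical.em (Z.1 = 0) with h0 | h0
  · have : Z.2 ≠ 0 := fun h2 => hZ (Prod.ext h0 h2)
    have := dot_self_pos this
    linarith
  · have := dot_self_pos h0
    linarith

/-- The vector dual with respect to `g₂` to the covector `(p, q)`. -/
noncomputable def sharp (m : R6) (p q : Fin 3 → ℝ) : R6 :=
  (fun i => 2 * len m.1 / (len m.1 + len m.2) * p i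
      + ((len m.1 * len m.2 - dot m.1 m.2) * (p i - q i) + m.1 i * (dot m.2 p - dot m.2 q)
        + m.2 i * (dot m.1 p - dot m.1 q) - m.1 i * (dot m.1 p + dot m.2 q))
        / (len m.1 + len m.2) ^ 2,
   fun i => 2 * len m.2 / (len m.1 + len m.2) * q i
      + ((len m.1 * len m.2 - dot m.1 m.2) * (q i - p i) + m.1 i * (dot m.2 q - dot m.2 p)
        + m.2 i * (dot m.1 q - dot m.1 p) - m.2 i * (dot m.1 p + dot m.2 q))
        / (len m.1 + len m.2) ^ 2)

theorem fderiv_Q_dualVec {x : R8} (hx : Q x ∈ smoothLocus) (p q : Fin 3 → ℝ) :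
    fderiv ℝ Q x (dualVec x p q) = sharp (Q x) p q := by
  have hR := (R_pos hx).ne'
  -- Euler's identity: Q is homogeneous of degree 2.
  have hQx : fderiv ℝ Q x x = (2 : ℝ) • Q x := by
    rw [fderiv_Q_apply]; ext i <;> fin_cases i <;> simp [Q] <;> ring
  -- The factor 2R² clears all denominators and leaves polynomial identities in x.
  have key : (2 * R x ^ 2) • fderiv ℝ Q x (dualVec x p q) = (2 * R x ^ 2) • sharp (Q x) p q := by
    simp only [dualVec, map_add, map_sub, map_smul, smul_add, smul_sub, smul_smul, hQx, sharp,
      len_Q_fst, len_Q_snd, ← R_eq_add]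
    rw [fderiv_Q_apply, fderiv_Q_apply, fderiv_Q_apply]
    have r1 : 2 * R x ^ 2 * (2 * R x)⁻¹ = R x := by field_simp
    have r2 : ∀ t, 2 * R x ^ 2 * (t / (4 * R x ^ 2) * 2) = t := fun t => by field_simp; ring
    have r3 : ∀ t, 2 * R x ^ 2 * (t / (2 * R x ^ 2)) = t := fun t => by field_simp
    have r4 : ∀ s t y : ℝ, 2 * R x ^ 2 * (2 * s / R x * y + t / R x ^ 2) =
      4 * s * R x * y + 2 * t := fun s t y => by field_simp; ring
    rw [r1, r2, r3, r3]
    refine Prod.ext (funext fun i => ?_) (funext fun i => ?_) <;>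
      simp only [Prod.fst_add, Prod.fst_sub, Prod.smul_fst, Prod.snd_add, Prod.snd_sub,
        Prod.smul_snd, Pi.add_apply, Pi.sub_apply, Pi.smul_apply, smul_eq_mul, r4] <;>
      simp only [R_eq_add, sqz, sqw, eucl_apply, alpha2_apply, alpha3_apply, cograd, Y2, Y3, dot,
        Q] <;>
      fin_cases i <;>
      simp only [Fin.zero_eta, Fin.mk_one, Fin.reduceFinMk, Matrix.cons_val_zero,
        Matrix.cons_val_one, Matrix.cons_val] <;>
      ring
  exact smul_right_injective R6 (by positivity : 2 * R x ^ 2 ≠ 0) key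

theorem g2_sharp {m : R6} (hm : m ∈ smoothLocus) (p q : Fin 3 → ℝ) (Y : R6) :
    g2 m (sharp m p q) Y = dot p Y.1 + dot q Y.2 := by
  obtain ⟨x, rfl⟩ := Q_surjective m
  rw [← fderiv_Q_dualVec hm, (g2_dualVec hm _ _ _).1]

/-! ### The almost complex structure -/

/-- The first component of the unnormalized almost complex structure. -/
noncomputable def rotNum (U V A B : Fin 3 → ℝ) : Fin 3 → ℝ := fun i =>
  (len U * (dot V B / len V) + len V * (dot U A / len U) + dot U B - 3 * dot V A) / 2 * U i
    - (2 * dot U A + len U * (dot V B / len V) + dot U B) * V i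
    - (len U * len V - dot U V) * A i
    - (2 * len U * (len U + len V) + len U * len V - dot U V) * B i

/-- The multiple `(|𝐮| + |𝐯|) N^{1/2} 𝕁` of the almost complex structure. -/
noncomputable def rot (m : R6) (W : R6) : R6 :=
  (rotNum m.1 m.2 W.1 W.2, fun i => -rotNum m.2 m.1 W.2 W.1 i)

/-- Applying `rot` twice needs only the pairings of 𝐮 and 𝐯 with the inner vector, so 𝕁² can be
computed from scalar products instead of coordinates. -/
theorem dot_rotNum (Z U V A B : Fin 3 → ℝ) : dot Z (rotNum U V A B) =
    (len U * (dot V B / len V) + len V * (dot U A / len U) + dot U B - 3 * dot V A) / 2 * dot Z U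
    - (2 * dot U A + len U * (dot V B / len V) + dot U B) * dot Z V
    - (len U * len V - dot U V) * dot Z A
    - (2 * len U * (len U + len V) + len U * len V - dot U V) * dot Z B := by
  unfold rotNum
  generalize dot V B / len V = b
  generalize dot U A / len U = a
  generalize len U = u
  generalize len V = v
  simp only [dot]
  ring

theorem dot_neg_rotNum (Z U V A B : Fin 3 → ℝ) : dot Z (fun i => -rotNum U V A B i) =
    -dot Z (rotNum U V A B) := by
  simp only [dot]; ring

theorem rotNum_neg_left (U V A B : Fin 3 → ℝ) (i : Fin 3) :
    rotNum U V (fun i => -A i) B i = -rotNum U V A (fun i => -B i) i := by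
  have h : ∀ Z A : Fin 3 → ℝ, dot Z (fun i => -A i) = -dot Z A := fun Z A => by
    simp only [dot]; ring
  simp only [rotNum, h]
  ring

/-- Once U·U and V·V become squared lengths, the coefficients of U, V and B cancel, and that of A is
the stated one. -/
theorem rotNum_rot {U V : Fin 3 → ℝ} (hU : len U ≠ 0) (hV : len V ≠ 0) (A B : Fin 3 → ℝ)
    (i : Fin 3) :
    rotNum U V (rotNum U V A B) (fun i => -rotNum V U B A i) i =
      -((len U + len V) ^ 2 * (6 * len U * len V - 2 * dot U V)) * A i := by
  rw [rotNum]
  simp only [dot_neg_rotNum, dot_rotNum]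
  simp only [rotNum, dot_comm V U, ← len_sq]
  field_simp
  ring

theorem rot_rot {m : R6} (hm : m ∈ smoothLocus) (W : R6) :
    rot m (rot m W) = -((len m.1 + len m.2) ^ 2 * N m) • W := by
  have h1 := (len_pos hm.1).ne'
  have h2 := (len_pos hm.2).ne'
  rw [N_eq hm]
  refine Prod.ext (funext fun i => ?_) (funext fun i => ?_)
  · exact rotNum_rot h1 h2 _ _ i
  · have h := rotNum_rot h2 h1 W.2 W.1 i
    -- The second component is the first with 𝐮 and 𝐯 exchanged, up to a sign that linearity moves
    -- to the other argument.
    have e : rotNum m.2 m.1 (fun i => -rotNum m.2 m.1 W.2 W.1 i) (rotNum m.1 m.2 W.1 W.2) i =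
        -rotNum m.2 m.1 (rotNum m.2 m.1 W.2 W.1) (fun i => -rotNum m.1 m.2 W.1 W.2 i) i := by
      exact rotNum_neg_left _ _ _ _ i
    change -rotNum m.2 m.1 (fun i => -rotNum m.2 m.1 W.2 W.1 i) (rotNum m.1 m.2 W.1 W.2) i = _
    rw [e, h, dot_comm m.2 m.1]
    simp only [Prod.smul_snd, Pi.smul_apply, smul_eq_mul]
    ring

theorem dot_add_right (Z A B : Fin 3 → ℝ) : dot Z (A + B) = dot Z A + dot Z B := by
  simp only [dot, Pi.add_apply]; ring

theorem dot_smul_right (Z A : Fin 3 → ℝ) (t : ℝ) : dot Z (t • A) = t * dot Z A := by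
  simp only [dot, Pi.smul_apply, smul_eq_mul]; ring

theorem rotNum_add (U V A B A' B' : Fin 3 → ℝ) :
    rotNum U V (A + A') (B + B') = rotNum U V A B + rotNum U V A' B' := by
  ext i
  simp only [rotNum, dot_add_right, Pi.add_apply]
  ring

theorem rotNum_smul (U V A B : Fin 3 → ℝ) (t : ℝ) :
    rotNum U V (t • A) (t • B) = t • rotNum U V A B := by
  ext i
  simp only [rotNum, dot_smul_right, Pi.smul_apply, smul_eq_mul]
  ring

/-- The normalizing factor `(|𝐮| + |𝐯|) N^{1/2}`. -/
noncomputable def rotScale (m : R6) : ℝ :=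
  (len m.1 + len m.2) * √(6 * len m.1 * len m.2 - 2 * dot m.1 m.2)

/-- The almost complex structure in explicit form. -/
noncomputable def Jexp (m : R6) : R6 →L[ℝ] R6 := LinearMap.toContinuousLinearMap
  { toFun := fun W => (rotScale m)⁻¹ • rot m W
    map_add' := fun W W' => by
      rw [← smul_add]
      congr 1
      refine Prod.ext (rotNum_add _ _ _ _ _ _) (funext fun i => ?_)
      simp only [rot, Prod.snd_add, Prod.fst_add, rotNum_add, Pi.add_apply]
      ring
    map_smul' := fun t W => by
      rw [RingHom.id_apply, smul_comm t]
      congr 1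
      refine Prod.ext (rotNum_smul _ _ _ _ _) (funext fun i => ?_)
      simp only [rot, Prod.smul_snd, Prod.smul_fst, rotNum_smul, Pi.smul_apply, smul_eq_mul]
      ring }

theorem Jexp_apply (m W : R6) : Jexp m W = (rotScale m)⁻¹ • rot m W := rfl

theorem rotScale_eq {m : R6} (hm : m ∈ smoothLocus) :
    rotScale m = (len m.1 + len m.2) * √(N m) := by rw [rotScale, N_eq hm]

theorem rotScale_pos {m : R6} (hm : m ∈ smoothLocus) : 0 < rotScale m := by
  rw [rotScale_eq hm]
  exact mul_pos (add_pos (len_pos hm.1) (len_pos hm.2)) (Real.sqrt_pos.2 (N_pos hm))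

theorem rot_smul (m W : R6) (t : ℝ) (h : rotScale m ≠ 0) : rot m (t • W) = t • rot m W := by
  have := (Jexp m).map_smul t W
  rw [Jexp_apply, Jexp_apply, smul_comm t] at this
  exact smul_right_injective R6 (inv_ne_zero h) this

theorem Jexp_Jexp {m : R6} (hm : m ∈ smoothLocus) (W : R6) : Jexp m (Jexp m W) = -W := by
  have h := (rotScale_pos hm).ne'
  rw [Jexp_apply, Jexp_apply, rot_smul _ _ _ h, rot_rot hm, smul_smul, smul_smul]
  have : (rotScale m)⁻¹ * (rotScale m)⁻¹ * -((len m.1 + len m.2) ^ 2 * N m) = -1 := by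
    have e : rotScale m ^ 2 = (len m.1 + len m.2) ^ 2 * N m := by
      rw [rotScale_eq hm, mul_pow, Real.sq_sqrt (N_pos hm).le]
    rw [← e]
    field_simp
  rw [this, neg_smul, one_smul]

theorem dot_left_comb (U V B Z : Fin 3 → ℝ) (a b c : ℝ) :
    dot (fun i => a * U i + b * V i + c * B i) Z = a * dot U Z + b * dot V Z + c * dot B Z := by
  simp only [dot]; ring

theorem g2_rot {m : R6} (hm : m ∈ smoothLocus) (W Y : R6) :
    g2 m (rot m W) Y = (len m.1 + len m.2) * sigma m ![W, Y] := by
  have hu := len_pos hm.1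
  have hv := len_pos hm.2
  have hr : len m.1 + len m.2 ≠ 0 := (add_pos hu hv).ne'
  have hu := hu.ne'
  have hv := hv.ne'
  -- (p, q) are the components of the covector W ⌟ σ, read off from `sigma_eq`.
  set p : Fin 3 → ℝ := fun i =>
    ((len m.1 + len m.2) * (dot m.2 W.2 / len m.2) - (dot m.1 W.2 - dot m.2 W.1)) / (2 * len m.1)
      * m.1 i + -(dot m.1 W.1 / len m.1 + dot m.2 W.2 / len m.2) / 2 * m.2 i
      + -(len m.1 + len m.2) * W.2 i with hp
  set q : Fin 3 → ℝ := fun i =>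
    (dot m.1 W.1 / len m.1 + dot m.2 W.2 / len m.2) / 2 * m.1 i
      + -((len m.1 + len m.2) * (dot m.1 W.1 / len m.1) + (dot m.1 W.2 - dot m.2 W.1))
        / (2 * len m.2) * m.2 i + (len m.1 + len m.2) * W.1 i with hq
  have e : rot m W = (len m.1 + len m.2) • sharp m p q := by
    refine Prod.ext (funext fun i => ?_) (funext fun i => ?_) <;>
      simp only [rot, rotNum, sharp, Prod.smul_fst, Prod.smul_snd, Pi.smul_apply, smul_eq_mul,
        dot_comm m.1 p, dot_comm m.2 p, dot_comm m.1 q, dot_comm m.2 q] <;>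
      simp only [hp, hq, dot_left_comb, dot_comm W.2, dot_comm W.1, dot_comm m.2 m.1, ← len_sq] <;>
      field_simp <;> ring
  rw [e, map_smul, smul_apply, smul_eq_mul, g2_sharp hm, sigma_eq hm]
  simp only [hp, hq, dot_left_comb]
  field_simp
  ring

theorem isInducedJ_Jexp {m : R6} (hm : m ∈ smoothLocus) : IsInducedJ m (Jexp m) := by
  intro W Y
  have hr := (add_pos (len_pos hm.1) (len_pos hm.2)).ne'
  have hN := (Real.sqrt_pos.2 (N_pos hm)).ne'
  rw [Jexp_apply, map_smul, smul_apply, smul_eq_mul, g2_rot hm, rotScale_eq hm,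
    ← Real.sqrt_eq_rpow]
  field_simp

theorem existsUnique_isInducedJ {m : R6} (hm : m ∈ smoothLocus) : ∃! A, IsInducedJ m A := by
  refine ⟨Jexp m, isInducedJ_Jexp hm, fun A hA => ?_⟩
  refine ContinuousLinearMap.ext fun W => sub_eq_zero.1 (g2_nondegenerate hm fun Y => ?_)
  have h := (hA W Y).symm.trans (isInducedJ_Jexp hm W Y)
  rw [map_sub, sub_apply, sub_eq_zero]
  exact mul_left_cancel₀ (Real.rpow_pos_of_pos (N_pos hm) _).ne' h

theorem J_eq {m : R6} (hm : m ∈ smoothLocus) : J m = Jexp m :=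
  (existsUnique_isInducedJ hm).unique
    (Classical.epsilon_spec (existsUnique_isInducedJ hm).exists) (isInducedJ_Jexp hm)

theorem J_comp_J {m : R6} (hm : m ∈ smoothLocus) :
    (J m).comp (J m) = -ContinuousLinearMap.id ℝ R6 := by
  rw [J_eq hm]
  exact ContinuousLinearMap.ext fun W => Jexp_Jexp hm W

/-! ### Smoothness of 𝕁 -/

theorem isOpen_smoothLocus : IsOpen smoothLocus :=
  (isOpen_ne_fun continuous_fst continuous_const).inter
    (isOpen_ne_fun continuous_snd continuous_const)

section Smooth

variable {E : Type*} [NormedAddCommGroup E] [NormedSpace ℝ E] {f g : E → Fin 3 → ℝ} {x : E}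

theorem contDiffAt_dot (hf : ContDiffAt ℝ ∞ f x) (hg : ContDiffAt ℝ ∞ g x) :
    ContDiffAt ℝ ∞ (fun y => dot (f y) (g y)) x := by
  have hf := contDiffAt_pi.1 hf
  have hg := contDiffAt_pi.1 hg
  exact (((hf 0).mul (hg 0)).add ((hf 1).mul (hg 1))).add ((hf 2).mul (hg 2))

theorem contDiffAt_len (hf : ContDiffAt ℝ ∞ f x) (h : f x ≠ 0) :
    ContDiffAt ℝ ∞ (fun y => len (f y)) x :=
  (contDiffAt_dot hf hf).sqrt (dot_self_pos h).ne'

theorem contDiffAt_rotNum (hf : ContDiffAt ℝ ∞ f x) (hg : ContDiffAt ℝ ∞ g x) (h : f x ≠ 0)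
    (h' : g x ≠ 0) (A B : Fin 3 → ℝ) :
    ContDiffAt ℝ ∞ (fun y => rotNum (f y) (g y) A B) x := by
  rw [contDiffAt_pi]
  intro i
  have lf := contDiffAt_len hf h
  have lg := contDiffAt_len hg h'
  have d := fun (C : Fin 3 → ℝ) => contDiffAt_dot hf (contDiffAt_const (c := C))
  have d' := fun (C : Fin 3 → ℝ) => contDiffAt_dot hg (contDiffAt_const (c := C))
  have e := contDiffAt_dot hf hg
  have a := (d A).div lf (len_pos h).ne'
  have b := (d' B).div lg (len_pos h').ne'
  have fi := contDiffAt_pi.1 hf i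
  have gi := contDiffAt_pi.1 hg i
  exact (((((((lf.mul b).add (lg.mul a)).add (d B)).sub (contDiffAt_const.mul (d' A))).div_const
    2).mul fi).sub ((((contDiffAt_const.mul (d A)).add (lf.mul b)).add (d B)).mul gi)).sub
    (((lf.mul lg).sub e).mul contDiffAt_const) |>.sub
    (((((contDiffAt_const.mul lf).mul (lf.add lg)).add (lf.mul lg)).sub e).mul contDiffAt_const)

end Smooth

theorem contDiffAt_rotScale {m : R6} (hm : m ∈ smoothLocus) : ContDiffAt ℝ ∞ rotScale m := by
  have hU : ContDiffAt ℝ ∞ (fun m : R6 => m.1) m := contDiffAt_fst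
  have hV : ContDiffAt ℝ ∞ (fun m : R6 => m.2) m := contDiffAt_snd
  have lU := contDiffAt_len hU hm.1
  have lV := contDiffAt_len hV hm.2
  refine (lU.add lV).mul (ContDiffAt.sqrt (((contDiffAt_const.mul lU).mul lV).sub
    (contDiffAt_const.mul (contDiffAt_dot hU hV))) ?_)
  have := N_pos hm
  rw [N_eq hm] at this
  exact this.ne'

theorem contDiffAt_rot {m : R6} (hm : m ∈ smoothLocus) (W : R6) :
    ContDiffAt ℝ ∞ (fun m => rot m W) m :=
  (contDiffAt_rotNum contDiffAt_fst contDiffAt_snd hm.1 hm.2 _ _).prodMk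
    (contDiffAt_rotNum contDiffAt_snd contDiffAt_fst hm.2 hm.1 _ _).neg

theorem contDiffAt_Jexp_apply {m : R6} (hm : m ∈ smoothLocus) (W : R6) :
    ContDiffAt ℝ ∞ (fun m => Jexp m W) m :=
  ((contDiffAt_rotScale hm).inv (rotScale_pos hm).ne').smul (contDiffAt_rot hm W)

theorem contDiffOn_J : ContDiffOn ℝ ∞ J smoothLocus := by
  have h : ContDiffOn ℝ ∞ Jexp smoothLocus := contDiffOn_clm_apply.2 fun W m hm =>
    (contDiffAt_Jexp_apply hm W).contDiffWithinAt
  exact h.congr fun m hm => J_eq hm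

/-! ### Integrability and the Nijenhuis tensor -/

/-- For coordinates f one has df[V,W] = D_V(df W) − D_W(df V). The relation df ∘ A = i df replaces
each A by i, all terms of df applied to the Nijenhuis tensor cancel through i² = −1, and df is
injective. -/
theorem nijenhuis_eq_zero {A : R6 → R6 →L[ℝ] R6} {U : Set R6} (hA : IsIntegrableOn A U) {m : R6}
    (hm : m ∈ U) (hd : ∀ w, DifferentiableAt ℝ (fun y => A y w) m) (v w : R6) :
    nijenhuis A m v w = 0 := by
  obtain ⟨O, hO, hmO, -, f, hf, hfA⟩ := hA m hm
  have hfm : ContDiffAt ℝ ∞ f m := hf.contDiffAt (hO.mem_nhds hmO)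
  have hn : minSmoothness ℝ 2 ≤ (∞ : WithTop ℕ∞) := by
    rw [minSmoothness_of_isRCLikeNormedField]; norm_cast
  have hdf : DifferentiableAt ℝ (fderiv ℝ f) m :=
    (hfm.fderiv_right (m := 1) (by norm_cast)).differentiableAt (by simp)
  have hA' : ∀ w, fderiv ℝ f m (A m w) = Complex.I • fderiv ℝ f m w := (hfA m hmO).2
  -- The relation df(Au) = i df(u) holds on a neighbourhood of m, so it may be differentiated.
  have hder : ∀ u : R6, fderiv ℝ (fun y => fderiv ℝ f y (A y u)) m =
      Complex.I • fderiv ℝ (fun y => fderiv ℝ f y u) m := by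
    intro u
    have : (fun y => fderiv ℝ f y (A y u)) =ᶠ[nhds m] fun y => Complex.I • fderiv ℝ f y u := by
      filter_upwards [hO.mem_nhds hmO] with y hy using (hfA y hy).2 u
    rw [this.fderiv_eq]
    exact fderiv_fun_const_smul (hdf.clm_apply (differentiableAt_const u)) _
  refine (hfA m hmO).1.1 ?_
  rw [map_zero]
  have hc : ∀ u : R6, DifferentiableAt ℝ (fun _ : R6 => u) m := fun u => differentiableAt_const u
  simp only [nijenhuis, map_sub, hA']
  rw [VectorField.fderiv_apply_lieBracket hfm hn (hd w) (hd v),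
    VectorField.fderiv_apply_lieBracket hfm hn (hc w) (hd v),
    VectorField.fderiv_apply_lieBracket hfm hn (hd w) (hc v),
    VectorField.fderiv_apply_lieBracket hfm hn (hc w) (hc v), hder, hder]
  ext i
  simp only [smul_apply, Pi.sub_apply, Pi.smul_apply, smul_eq_mul, Pi.zero_apply]
  linear_combination ((fderiv ℝ (fun y => fderiv ℝ f y v) m w i) -
    (fderiv ℝ (fun y => fderiv ℝ f y w) m v i)) * Complex.I_mul_I

/-! ### Derivatives of the ingredients of 𝕁 along curves -/

section Curves

variable {t : ℝ}

theorem hasDerivAt_dot {P S : Fin 3 → ℝ} {U V : ℝ → Fin 3 → ℝ} (hU : HasDerivAt U P t)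
    (hV : HasDerivAt V S t) :
    HasDerivAt (fun t => dot (U t) (V t)) (dot P (V t) + dot (U t) S) t := by
  have hU := hasDerivAt_pi.1 hU
  have hV := hasDerivAt_pi.1 hV
  refine ((((hU 0).mul (hV 0)).add ((hU 1).mul (hV 1))).add ((hU 2).mul (hV 2))).congr_deriv ?_
  simp only [dot]; ring

theorem hasDerivAt_len {P : Fin 3 → ℝ} {U : ℝ → Fin 3 → ℝ} (hU : HasDerivAt U P t)
    (h : U t ≠ 0) : HasDerivAt (fun t => len (U t)) (dot (U t) P / len (U t)) t := by
  refine ((hasDerivAt_dot hU hU).sqrt (dot_self_pos h).ne').congr_deriv ?_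
  have := (len_pos h).ne'
  rw [dot_comm P, ← len]
  field_simp
  ring

/-- The lengths and their derivatives are separate parameters so that, at a chosen point, rational
values can replace the square roots. -/
theorem hasDerivAt_rotNum {P S : Fin 3 → ℝ} {U V : ℝ → Fin 3 → ℝ} (hU : HasDerivAt U P t)
    (hV : HasDerivAt V S t) (h : U t ≠ 0) (h' : V t ≠ 0) (A B : Fin 3 → ℝ) (i : Fin 3)
    {u v u' v' : ℝ} (hu : u = len (U t)) (hv : v = len (V t))
    (hu' : u' = dot (U t) P / u) (hv' : v' = dot (V t) S / v) :
    HasDerivAt (fun t => rotNum (U t) (V t) A B i)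
      ((u' * (dot (V t) B / v) + u * ((dot S B * v - dot (V t) B * v') / v ^ 2)
          + v' * (dot (U t) A / u) + v * ((dot P A * u - dot (U t) A * u') / u ^ 2)
          + dot P B - 3 * dot S A) / 2 * U t i
        + (u * (dot (V t) B / v) + v * (dot (U t) A / u) + dot (U t) B - 3 * dot (V t) A) / 2 * P i
        - (2 * dot P A + u' * (dot (V t) B / v) + u * ((dot S B * v - dot (V t) B * v') / v ^ 2)
          + dot P B) * V t i
        - (2 * dot (U t) A + u * (dot (V t) B / v) + dot (U t) B) * S i
        - (u' * v + u * v' - (dot P (V t) + dot (U t) S)) * A i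
        - (2 * u' * (u + v) + 2 * u * (u' + v') + u' * v + u * v'
          - (dot P (V t) + dot (U t) S)) * B i) t := by
  have d := fun C : Fin 3 → ℝ => hasDerivAt_dot hU (hasDerivAt_const t C)
  have d' := fun C : Fin 3 → ℝ => hasDerivAt_dot hV (hasDerivAt_const t C)
  have e := hasDerivAt_dot hU hV
  have lu := hasDerivAt_len hU h
  have lv := hasDerivAt_len hV h'
  have a := (d A).div lu (len_pos h).ne'
  have b := (d' B).div lv (len_pos h').ne'
  have z : ∀ Z : Fin 3 → ℝ, dot Z 0 = 0 := fun Z => by simp [dot]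
  refine ((((((((lu.mul b).add (lv.mul a)).add (d B)).sub ((d' A).const_mul 3)).div_const
    2).mul (hasDerivAt_pi.1 hU i)).sub (((((d A).const_mul 2).add (lu.mul b)).add (d B)).mul
    (hasDerivAt_pi.1 hV i))).sub (((lu.mul lv).sub e).mul_const (A i)) |>.sub
    ((((((lu.const_mul 2).mul (lu.add lv))).add (lu.mul lv)).sub e).mul_const (B i))).congr_deriv ?_
  simp only [Pi.add_apply, Pi.mul_apply, Pi.sub_apply, Pi.div_apply, z]
  rw [hu', hv', hu, hv]
  ring

theorem hasDerivAt_rotScale {P S : Fin 3 → ℝ} {U V : ℝ → Fin 3 → ℝ} (hU : HasDerivAt U P t)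
    (hV : HasDerivAt V S t) (h : (U t, V t) ∈ smoothLocus)
    {u v u' v' n : ℝ} (hu : u = len (U t)) (hv : v = len (V t))
    (hu' : u' = dot (U t) P / u) (hv' : v' = dot (V t) S / v)
    (hn : n = √(6 * u * v - 2 * dot (U t) (V t))) :
    HasDerivAt (fun t => rotScale (U t, V t))
      ((u' + v') * n + (u + v) * ((3 * (u' * v + u * v') - (dot P (V t) + dot (U t) S)) / n)) t := by
  have lu := hasDerivAt_len hU h.1
  have lv := hasDerivAt_len hV h.2
  have hN := N_pos h
  rw [N_eq h] at hN
  refine ((lu.add lv).mul ((((lu.const_mul 6).mul lv).sub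
    ((hasDerivAt_dot hU hV).const_mul 2)).sqrt hN.ne')).congr_deriv ?_
  simp only [Pi.add_apply, Pi.mul_apply, Pi.sub_apply]
  rw [hn, hu', hv', hu, hv]
  ring

end Curves

/-! ### A nonzero component of the Nijenhuis tensor -/

/-- The point `𝐮 = 𝐯 = (3, 0, 0)`. -/
def axisPoint : R6 := (![3, 0, 0], ![3, 0, 0])

theorem vec3_ne_zero {a b c : ℝ} (h : a ≠ 0) : (![a, b, c] : Fin 3 → ℝ) ≠ 0 :=
  fun h' => h (congrFun h' 0)

theorem axisPoint_mem : axisPoint ∈ smoothLocus :=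
  ⟨vec3_ne_zero (by norm_num), vec3_ne_zero (by norm_num)⟩

theorem dot_axis (a b : Fin 3 → ℝ) : dot ![3, 0, 0] b = 3 * b 0 ∧ dot a ![3, 0, 0] = 3 * a 0 := by
  constructor <;> simp [dot]
  ring

theorem len_axis : len ![3, 0, 0] = 3 := by
  rw [len, (dot_axis 0 _).1, Real.sqrt_eq_iff_eq_sq] <;> norm_num

theorem sqrt_axis : (6 : ℝ) = √(6 * 3 * 3 - 2 * dot ![3, 0, 0] ![3, 0, 0]) := by
  symm
  rw [(dot_axis 0 _).1, Real.sqrt_eq_iff_eq_sq] <;> norm_num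

theorem rotScale_axisPoint : rotScale axisPoint = 36 := by
  rw [rotScale, axisPoint, len_axis, ← sqrt_axis]
  norm_num

theorem rotNum_axis (A B : Fin 3 → ℝ) (i : Fin 3) : rotNum ![3, 0, 0] ![3, 0, 0] A B i =
    (3 * B 0 - 3 * A 0) * (![3, 0, 0] : Fin 3 → ℝ) i
      - 6 * (A 0 + B 0) * (![3, 0, 0] : Fin 3 → ℝ) i - 36 * B i := by
  simp only [rotNum, len_axis, (dot_axis 0 _).1, Matrix.cons_val_zero]
  ring

/-- At `axisPoint`, 𝕁 exchanges the coordinates of index 1 of the two factors up to sign. Hence the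
index 1 part of the Nijenhuis tensor involves only these two components of the derivative of 𝕁,
obtained by the quotient rule along a line. -/
theorem fderiv_Jexp_axisPoint (W Z : R6) :
    (fderiv ℝ (fun y => Jexp y W) axisPoint Z).1 1 =
        ((W.2 0 - W.1 0) * Z.1 1 - 2 * (W.1 0 + W.2 0) * Z.2 1
          + 2 * (Z.2 0 - Z.1 0) * W.2 1) / 12 ∧
    (fderiv ℝ (fun y => Jexp y W) axisPoint Z).2 1 =
        -((W.1 0 - W.2 0) * Z.2 1 - 2 * (W.1 0 + W.2 0) * Z.1 1
          + 2 * (Z.1 0 - Z.2 0) * W.1 1) / 12 := by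
  have h := ((contDiffAt_Jexp_apply axisPoint_mem W).differentiableAt (by simp)).hasFDerivAt
  have hU : HasDerivAt (fun t : ℝ => axisPoint.1 + t • Z.1) Z.1 0 := by
    simpa using ((hasDerivAt_id (0 : ℝ)).smul_const Z.1).const_add axisPoint.1
  have hV : HasDerivAt (fun t : ℝ => axisPoint.2 + t • Z.2) Z.2 0 := by
    simpa using ((hasDerivAt_id (0 : ℝ)).smul_const Z.2).const_add axisPoint.2
  have eU : axisPoint.1 + (0 : ℝ) • Z.1 = ![3, 0, 0] := by simp [axisPoint]
  have eV : axisPoint.2 + (0 : ℝ) • Z.2 = ![3, 0, 0] := by simp [axisPoint]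
  have hne : (![3, 0, 0] : Fin 3 → ℝ) ≠ 0 := vec3_ne_zero (by norm_num)
  have hs := hasDerivAt_rotScale (u := 3) (v := 3) (n := 6) hU hV
    (by rw [eU, eV]; exact axisPoint_mem)
    (by rw [eU, len_axis]) (by rw [eV, len_axis]) rfl rfl (by rw [eU, eV]; exact sqrt_axis)
  have h1 := hasDerivAt_rotNum (u := 3) (v := 3) hU hV (by rwa [eU]) (by rwa [eV]) W.1 W.2 1
    (by rw [eU, len_axis]) (by rw [eV, len_axis]) rfl rfl
  have h2 := hasDerivAt_rotNum (u := 3) (v := 3) hV hU (by rwa [eV]) (by rwa [eU]) W.2 W.1 1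
    (by rw [eV, len_axis]) (by rw [eU, len_axis]) rfl rfl
  have hs0 : rotScale (axisPoint.1 + (0 : ℝ) • Z.1, axisPoint.2 + (0 : ℝ) • Z.2) = 36 := by
    rw [eU, eV]; exact rotScale_axisPoint
  have q1 := h1.div hs (by rw [hs0]; norm_num)
  have q2 := h2.neg.div hs (by rw [hs0]; norm_num)
  have hs1 : rotScale (![3, 0, 0], ![3, 0, 0]) = 36 := rotScale_axisPoint
  have hγ := hU.prodMk hV
  have e0 : (axisPoint.1 + (0 : ℝ) • Z.1, axisPoint.2 + (0 : ℝ) • Z.2) = axisPoint := by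
    rw [eU, eV]; rfl
  rw [← e0] at h
  have hJ := h.comp_hasDerivAt 0 hγ
  rw [e0] at hJ
  have hJ1 := hasDerivAt_pi.1
    ((ContinuousLinearMap.fst ℝ (Fin 3 → ℝ) (Fin 3 → ℝ)).hasFDerivAt.comp_hasDerivAt 0 hJ) 1
  have hJ2 := hasDerivAt_pi.1
    ((ContinuousLinearMap.snd ℝ (Fin 3 → ℝ) (Fin 3 → ℝ)).hasFDerivAt.comp_hasDerivAt 0 hJ) 1
  have z1 : (![3, 0, 0] : Fin 3 → ℝ) 1 = 0 := rfl
  constructor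
  · refine hJ1.unique ((q1.congr_of_eventuallyEq (Filter.Eventually.of_forall fun t => ?_)).congr_deriv
      ?_)
    · exact (div_eq_inv_mul _ _).symm
    · simp only [hs1, eU, eV, rotNum_axis, z1, (dot_axis 0 _).1, (dot_axis _ 0).2]
      ring
  · refine hJ2.unique ((q2.congr_of_eventuallyEq (Filter.Eventually.of_forall fun t => ?_)).congr_deriv
      ?_)
    · exact (div_eq_inv_mul _ _).symm
    · simp only [hs1, eU, eV, rotNum_axis, Pi.neg_apply, z1, (dot_axis 0 _).1, (dot_axis _ 0).2]
      ring

theorem Jexp_axisPoint_apply (W : R6) (i : Fin 3) :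
    (Jexp axisPoint W).1 i = ((W.2 0 - W.1 0 - 2 * (W.1 0 + W.2 0)) *
        (![3, 0, 0] : Fin 3 → ℝ) i / 12 - W.2 i) ∧
    (Jexp axisPoint W).2 i = -((W.1 0 - W.2 0 - 2 * (W.1 0 + W.2 0)) *
        (![3, 0, 0] : Fin 3 → ℝ) i / 12 - W.1 i) := by
  rw [Jexp_apply, rotScale_axisPoint]
  constructor
  · change (36 : ℝ)⁻¹ * rotNum ![3, 0, 0] ![3, 0, 0] W.1 W.2 i = _
    rw [rotNum_axis]
    ring
  · change (36 : ℝ)⁻¹ * -rotNum ![3, 0, 0] ![3, 0, 0] W.2 W.1 i = _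
    rw [rotNum_axis]
    ring

theorem J_eventuallyEq {m : R6} (hm : m ∈ smoothLocus) (w : R6) :
    (fun y => J y w) =ᶠ[nhds m] fun y => Jexp y w := by
  filter_upwards [isOpen_smoothLocus.mem_nhds hm] with y hy
  rw [J_eq hy]

theorem differentiableAt_J_apply {m : R6} (hm : m ∈ smoothLocus) (w : R6) :
    DifferentiableAt ℝ (fun y => J y w) m :=
  ((contDiffAt_Jexp_apply hm w).differentiableAt (by simp)).congr_of_eventuallyEq
    (J_eventuallyEq hm w)

theorem nijenhuis_axisPoint :
    (nijenhuis J axisPoint (![1, 0, 0], 0) (![0, 1, 0], 0)).2 1 = 1 / 3 := by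
  simp only [nijenhuis, VectorField.lieBracket, (J_eventuallyEq axisPoint_mem _).fderiv_eq,
    J_eq axisPoint_mem, fderiv_fun_const, Pi.zero_apply, zero_apply, sub_zero, zero_sub, map_neg,
    Prod.snd_sub, Prod.snd_neg, Pi.sub_apply, Pi.neg_apply, Jexp_axisPoint_apply,
    fderiv_Jexp_axisPoint]
  simp
  norm_num

theorem not_isIntegrableOn_J : ¬ IsIntegrableOn J smoothLocus := fun h => by
  have h1 := nijenhuis_axisPoint
  rw [nijenhuis_eq_zero h axisPoint_mem (differentiableAt_J_apply axisPoint_mem)] at h1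
  norm_num at h1

/-! ### Smoothness of `ψ⁻` -/

/-- The covector `h₂(X, ·)`, written polynomially. -/
noncomputable def xFlat (x : R8) : R8 →L[ℝ] ℝ :=
  (2 * R x) • eucl (XL x) - (2 * alpha1 x (XL x)) • alpha1 x - alpha2 x (XL x) • alpha2 x
    - alpha3 x (XL x) • alpha3 x

theorem xFlat_eq {x : R8} (hx : R x ≠ 0) : h2 x (X x) = xFlat x := by
  ext b
  rw [h2_apply hx, eucl_X]
  simp only [xFlat, sub_apply, smul_apply, smul_eq_mul]
  change _ = 2 * R x * eucl (X x) b - 2 * alpha1 x (X x) * alpha1 x b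
    - alpha2 x (X x) * alpha2 x b - alpha3 x (X x) * alpha3 x b
  ring

theorem contDiff_xFlat : ContDiff ℝ ∞ xFlat := by
  have hR := contDiff_R
  have q := fun A : R8 →L[ℝ] R8 →L[ℝ] ℝ => A.contDiff (n := ∞) |>.clm_apply (XL.contDiff (n := ∞))
  exact ((((contDiff_const.mul hR).smul (eucl.comp XL).contDiff).sub
    ((contDiff_const.mul (q alpha1)).smul alpha1.contDiff)).sub
    ((q alpha2).smul alpha2.contDiff)).sub ((q alpha3).smul alpha3.contDiff)

theorem R_eventually_ne {x : R8} (hx : R x ≠ 0) : ∀ᶠ y in nhds x, R y ≠ 0 :=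
  (hasFDerivAt_R x).continuousAt.eventually_ne hx

theorem contDiffAt_normSqX {x : R8} (hx : R x ≠ 0) : ContDiffAt ℝ ∞ normSqX x := by
  refine (contDiff_xFlat.contDiffAt.clm_apply XL.contDiff.contDiffAt).congr_of_eventuallyEq ?_
  filter_upwards [R_eventually_ne hx] with y hy
  rw [normSqX, xFlat_eq hy]
  rfl

theorem contDiffAt_theta {x : R8} (hx : R x ≠ 0) (hN : normSqX x ≠ 0) : ContDiffAt ℝ ∞ theta x := by
  refine (((contDiffAt_normSqX hx).inv hN).smul
    contDiff_xFlat.contDiffAt).congr_of_eventuallyEq ?_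
  filter_upwards [R_eventually_ne hx] with y hy
  rw [theta, xFlat_eq hy]
  rfl

theorem isBoundedLinearMap_curryLeft (E : Type*) [NormedAddCommGroup E] [NormedSpace ℝ E] (n : ℕ) :
    IsBoundedLinearMap ℝ (fun f : E [⋀^Fin (n + 1)]→L[ℝ] ℝ => f.curryLeft) where
  map_add f g := ContinuousAlternatingMap.curryLeft_add f g
  map_smul c f := ContinuousAlternatingMap.curryLeft_smul c f
  bound := ⟨1, one_pos, fun f => by rw [one_mul]; exact f.norm_curryLeft.le⟩

theorem contDiff_curryLeft (E : Type*) [NormedAddCommGroup E] [NormedSpace ℝ E] (n : ℕ) :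
    ContDiff ℝ ∞ (fun f : E [⋀^Fin (n + 1)]→L[ℝ] ℝ => f.curryLeft) :=
  (isBoundedLinearMap_curryLeft E n).contDiff

theorem contDiffAt_contractedForm {x : R8} (hx : R x ≠ 0) : ContDiffAt ℝ ∞ contractedForm x := by
  have h : ContDiffAt ℝ ∞ (fun y => (phi y).curryLeft) x :=
    (contDiff_curryLeft R8 2).contDiffAt.comp x (phi_contDiffAt hx)
  exact h.clm_apply XL.contDiff.contDiffAt

/-- The form `N^{-1/4} ψ⁻`, pulled back to `ℝ⁸`. -/
noncomputable def scaledPsiUp (x : R8) : R8 [⋀^Fin 3]→L[ℝ] ℝ :=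
  √(normSqX x) • (phi x - wedge (theta x) (contractedForm x))

theorem contDiffAt_scaledPsiUp {x : R8} (hx : Q x ∈ smoothLocus) :
    ContDiffAt ℝ ∞ scaledPsiUp x := by
  have hR := (R_pos hx).ne'
  have hN := (normSqX_pos hx).ne'
  exact ((contDiffAt_normSqX hR).sqrt hN).smul ((phi_contDiffAt hR).sub
    (contDiffAt_wedge (contDiffAt_theta hR hN) (contDiffAt_contractedForm hR)))

/-- The form `N^{-1/4} ψ⁻` on the quotient. -/
noncomputable def scaledPsi (m : R6) : R6 [⋀^Fin 3]→L[ℝ] ℝ := (N m ^ (-(1 / 4) : ℝ)) • psiMinus m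

/-- The exponents add up to −1/4 + 3/4 = 1/2. -/
theorem scaledPsi_Q {x : R8} (hx : Q x ∈ smoothLocus) :
    (scaledPsi (Q x)).compContinuousLinearMap (fderiv ℝ Q x) = scaledPsiUp x := by
  have h : (scaledPsi (Q x)).compContinuousLinearMap (fderiv ℝ Q x) =
      (N (Q x) ^ (-(1 / 4) : ℝ)) • (psiMinus (Q x)).compContinuousLinearMap (fderiv ℝ Q x) := by
    ext v; rfl
  rw [h, psiMinus_Q hx, N_Q hx, psiMinusUp, smul_smul, ← Real.rpow_add (normSqX_pos hx),
    scaledPsiUp, Real.sqrt_eq_rpow]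
  norm_num

/-! ### A local section of Q and the descent of d -/

/-- A local section of `Q`. -/
noncomputable def section6 (m : R6) : R8 :=
  ![hopfRoot m.1, 0, hopfRoot m.2, 0, m.1 1 / (2 * hopfRoot m.1), m.1 2 / (2 * hopfRoot m.1),
    m.2 1 / (2 * hopfRoot m.2), m.2 2 / (2 * hopfRoot m.2)]

theorem Q_section6 {m : R6} (h1 : 0 < len m.1 + m.1 0) (h2 : 0 < len m.2 + m.2 0) :
    Q (section6 m) = m := by
  have p1 := (hopfRoot_pos h1).ne'
  have p2 := (hopfRoot_pos h2).ne'
  have s1 := hopfRoot_section h1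
  have s2 := hopfRoot_section h2
  refine Prod.ext (funext fun i => ?_) (funext fun i => ?_)
  · fin_cases i
    · simp [Q, section6]; exact s1
    · simp [Q, section6]; field_simp
    · simp [Q, section6]; field_simp
  · fin_cases i
    · simp [Q, section6]; exact s2
    · simp [Q, section6]; field_simp
    · simp [Q, section6]; field_simp

theorem contDiffAt_hopfRoot {U : Fin 3 → ℝ} (hU : U ≠ 0) (h : 0 < len U + U 0) :
    ContDiffAt ℝ ∞ hopfRoot U :=
  (((contDiffAt_len contDiffAt_id hU).add (contDiff_apply ℝ ℝ 0).contDiffAt).div_const 2).sqrt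
    (by positivity)

theorem contDiffAt_section6 {m : R6} (hm : m ∈ smoothLocus) (h1 : 0 < len m.1 + m.1 0)
    (h2 : 0 < len m.2 + m.2 0) : ContDiffAt ℝ ∞ section6 m := by
  have r1 : ContDiffAt ℝ ∞ (fun m : R6 => hopfRoot m.1) m :=
    ContDiffAt.comp (g := hopfRoot) m (contDiffAt_hopfRoot hm.1 h1) contDiffAt_fst
  have r2 : ContDiffAt ℝ ∞ (fun m : R6 => hopfRoot m.2) m :=
    ContDiffAt.comp (g := hopfRoot) m (contDiffAt_hopfRoot hm.2 h2) contDiffAt_snd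
  have c1 : ∀ i, ContDiffAt ℝ ∞ (fun m : R6 => m.1 i) m := contDiffAt_pi.1 contDiffAt_fst
  have c2 : ∀ i, ContDiffAt ℝ ∞ (fun m : R6 => m.2 i) m := contDiffAt_pi.1 contDiffAt_snd
  have n1 : 2 * hopfRoot m.1 ≠ 0 := mul_ne_zero two_ne_zero (hopfRoot_pos h1).ne'
  have n2 : 2 * hopfRoot m.2 ≠ 0 := mul_ne_zero two_ne_zero (hopfRoot_pos h2).ne'
  rw [contDiffAt_pi]
  intro i
  fin_cases i
  · exact r1
  · exact contDiffAt_const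
  · exact r2
  · exact contDiffAt_const
  · exact (c1 1).div (contDiffAt_const.mul r1) n1
  · exact (c1 2).div (contDiffAt_const.mul r1) n1
  · exact (c2 1).div (contDiffAt_const.mul r2) n2
  · exact (c2 2).div (contDiffAt_const.mul r2) n2

theorem eventually_section6 {m : R6} (hm : m ∈ smoothLocus) (h1 : 0 < len m.1 + m.1 0)
    (h2 : 0 < len m.2 + m.2 0) : ∀ᶠ y in nhds m, Q (section6 y) = y := by
  have l1 := ((contDiffAt_len contDiffAt_fst hm.1).add
    (contDiffAt_pi.1 contDiffAt_fst 0)).continuousAt.eventually_const_lt h1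
  have l2 := ((contDiffAt_len contDiffAt_snd hm.2).add
    (contDiffAt_pi.1 contDiffAt_snd 0)).continuousAt.eventually_const_lt h2
  filter_upwards [l1, l2] with y hy1 hy2 using Q_section6 hy1 hy2

/-- The pullback rule for d needs regularity on the quotient, where the form is only defined
pointwise. For a local section s of Q, the form equals s^* of its pullback by Q, which is smooth. -/
theorem differentiableAt_scaledPsi {m : R6} (hm : m ∈ smoothLocus) (h1 : 0 < len m.1 + m.1 0)
    (h2 : 0 < len m.2 + m.2 0) : DifferentiableAt ℝ scaledPsi m := by
  have hs := contDiffAt_section6 hm h1 h2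
  have e := eventually_section6 hm h1 h2
  have hQm : Q (section6 m) = m := e.self_of_nhds
  have hup : DifferentiableAt ℝ (fun y => scaledPsiUp (section6 y)) m :=
    DifferentiableAt.comp m ((contDiffAt_scaledPsiUp (by rwa [hQm])).differentiableAt (by simp))
      (hs.differentiableAt (by simp))
  have hds : DifferentiableAt ℝ (fderiv ℝ section6) m :=
    (hs.fderiv_right (m := 1) (by norm_cast)).differentiableAt (by simp)
  refine (hup.continuousAlternatingMapCompContinuousLinearMap hds).congr_of_eventuallyEq ?_
  filter_upwards [e.eventually_nhds, isOpen_smoothLocus.mem_nhds hm,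
    (hs.of_le (m := 1) (by norm_cast)).eventually (by simp)] with y hy hym hys
  have hy0 : Q (section6 y) = y := hy.self_of_nhds
  have hc : (fderiv ℝ Q (section6 y)).comp (fderiv ℝ section6 y) = ContinuousLinearMap.id ℝ R6 := by
    rw [← fderiv_comp y ((contDiff_Q.differentiable (by simp)).differentiableAt)
      (hys.differentiableAt (by simp))]
    have : Q ∘ section6 =ᶠ[nhds y] id := hy
    rw [this.fderiv_eq, fderiv_id]
  rw [← scaledPsi_Q (by rwa [hy0]), hy0]
  ext v
  have : ∀ w, fderiv ℝ Q (section6 y) (fderiv ℝ section6 y w) = w :=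
    fun w => DFunLike.congr_fun hc w
  simp [Function.comp_def, this]

theorem extDeriv_scaledPsi_ne_zero {x : R8} (hx : Q x ∈ smoothLocus)
    (h1 : 0 < len (Q x).1 + (Q x).1 0) (h2 : 0 < len (Q x).2 + (Q x).2 0)
    (h : extDeriv scaledPsiUp x ≠ 0) : extDeriv scaledPsi (Q x) ≠ 0 := by
  intro h0
  apply h
  have e : scaledPsiUp =ᶠ[nhds x]
      fun y => (scaledPsi (Q y)).compContinuousLinearMap (fderiv ℝ Q y) := by
    filter_upwards [contDiff_Q.continuous.continuousAt.preimage_mem_nhds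
      (isOpen_smoothLocus.mem_nhds hx)] with y hy using (scaledPsi_Q hy).symm
  rw [e.extDeriv_eq, extDeriv_pullback (differentiableAt_scaledPsi hx h1 h2)
    (contDiff_Q.contDiffAt) (by rw [minSmoothness_of_isRCLikeNormedField]; norm_cast), h0]
  rfl

/-! ### The exterior derivative of `N^{-1/4} ψ⁻` at two points -/

/-- The value of `φ`, as a polynomial. -/
noncomputable def phiPoly (x a b c : R8) : ℝ :=
  4 * R x * (eucl x a * alpha1 b c - eucl x b * alpha1 a c + eucl x c * alpha1 a b)
    + 2 * (eucl x a * (alpha2 x b * alpha3 x c - alpha2 x c * alpha3 x b)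
      - eucl x b * (alpha2 x a * alpha3 x c - alpha2 x c * alpha3 x a)
      + eucl x c * (alpha2 x a * alpha3 x b - alpha2 x b * alpha3 x a))
    + 2 * R x * (alpha2 a b * alpha3 x c - alpha2 a c * alpha3 x b + alpha2 b c * alpha3 x a
      - alpha3 a b * alpha2 x c + alpha3 a c * alpha2 x b - alpha3 b c * alpha2 x a)

/-- The derivative of `phiPoly` at `x` in the direction `e`. -/
noncomputable def phiPoly' (x e a b c : R8) : ℝ :=
  8 * eucl x e * (eucl x a * alpha1 b c - eucl x b * alpha1 a c + eucl x c * alpha1 a b)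
    + 4 * R x * (eucl e a * alpha1 b c - eucl e b * alpha1 a c + eucl e c * alpha1 a b)
    + 2 * (eucl e a * (alpha2 x b * alpha3 x c - alpha2 x c * alpha3 x b)
      - eucl e b * (alpha2 x a * alpha3 x c - alpha2 x c * alpha3 x a)
      + eucl e c * (alpha2 x a * alpha3 x b - alpha2 x b * alpha3 x a))
    + 2 * (eucl x a * (alpha2 e b * alpha3 x c - alpha2 e c * alpha3 x b
        + alpha2 x b * alpha3 e c - alpha2 x c * alpha3 e b)
      - eucl x b * (alpha2 e a * alpha3 x c - alpha2 e c * alpha3 x a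
        + alpha2 x a * alpha3 e c - alpha2 x c * alpha3 e a)
      + eucl x c * (alpha2 e a * alpha3 x b - alpha2 e b * alpha3 x a
        + alpha2 x a * alpha3 e b - alpha2 x b * alpha3 e a))
    + 4 * eucl x e * (alpha2 a b * alpha3 x c - alpha2 a c * alpha3 x b + alpha2 b c * alpha3 x a
      - alpha3 a b * alpha2 x c + alpha3 a c * alpha2 x b - alpha3 b c * alpha2 x a)
    + 2 * R x * (alpha2 a b * alpha3 e c - alpha2 a c * alpha3 e b + alpha2 b c * alpha3 e a
      - alpha3 a b * alpha2 e c + alpha3 a c * alpha2 e b - alpha3 b c * alpha2 e a)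

theorem hasDerivAt_line (x e : R8) : HasDerivAt (fun t : ℝ => x + t • e) e 0 := by
  simpa using ((hasDerivAt_id (0 : ℝ)).smul_const e).const_add x

theorem hasDerivAt_clm_line {F : Type*} [NormedAddCommGroup F] [NormedSpace ℝ F]
    (A : R8 →L[ℝ] F) (x e : R8) : HasDerivAt (fun t : ℝ => A (x + t • e)) (A e) 0 :=
  A.hasFDerivAt.comp_hasDerivAt (0 : ℝ) (hasDerivAt_line x e)

theorem hasDerivAt_R_line (x e : R8) :
    HasDerivAt (fun t : ℝ => R (x + t • e)) (2 * eucl x e) 0 := by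
  have h0 : x + (0 : ℝ) • e = x := by simp
  have h := hasFDerivAt_R (x + (0 : ℝ) • e)
  have h' := h.comp_hasDerivAt (0 : ℝ) (hasDerivAt_line x e)
  rw [h0] at h'
  exact h'

theorem hasDerivAt_bilin_line (A : R8 →L[ℝ] R8 →L[ℝ] ℝ) (x e : R8) {f : ℝ → R8} {f' : R8}
    (hf : HasDerivAt f f' 0) :
    HasDerivAt (fun t : ℝ => A (x + t • e) (f t)) (A e (f 0) + A x f') 0 := by
  simpa using (hasDerivAt_clm_line A x e).clm_apply hf

/-- The first slot is allowed to move because it will be occupied by X, which varies with the point.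
-/
theorem hasDerivAt_phiPoly (x e b c : R8) {f : ℝ → R8} {f' : R8} (hf : HasDerivAt f f' 0) :
    HasDerivAt (fun t : ℝ => phiPoly (x + t • e) (f t) b c)
      (phiPoly' x e (f 0) b c + phiPoly x f' b c) 0 := by
  have hR := hasDerivAt_R_line x e
  have l := fun (A : R8 →L[ℝ] R8 →L[ℝ] ℝ) (b : R8) =>
    hasDerivAt_bilin_line A x e (hasDerivAt_const (0 : ℝ) b)
  have q := fun (A : R8 →L[ℝ] R8 →L[ℝ] ℝ) => hasDerivAt_bilin_line A x e hf
  have k := fun (A : R8 →L[ℝ] R8 →L[ℝ] ℝ) (b : R8) =>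
    (A.flip b).hasFDerivAt.comp_hasDerivAt (0 : ℝ) hf
  have u₁ := ((q eucl).mul_const (alpha1 b c)).sub ((l eucl b).mul (k alpha1 c))
  have h₁ := (hR.const_mul 4).mul (u₁.add ((l eucl c).mul (k alpha1 b)))
  have u₂ := (q eucl).mul (((l alpha2 b).mul (l alpha3 c)).sub ((l alpha2 c).mul (l alpha3 b)))
  have v₂ := (l eucl b).mul (((q alpha2).mul (l alpha3 c)).sub ((l alpha2 c).mul (q alpha3)))
  have w₂ := (l eucl c).mul (((q alpha2).mul (l alpha3 b)).sub ((l alpha2 b).mul (q alpha3)))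
  have h₂ := ((u₂.sub v₂).add w₂).const_mul 2
  have u₃ := (((k alpha2 b).mul (l alpha3 c)).sub ((k alpha2 c).mul (l alpha3 b))).add
    ((q alpha3).const_mul (alpha2 b c))
  have v₃ := (u₃.sub ((k alpha3 b).mul (l alpha2 c))).add ((k alpha3 c).mul (l alpha2 b))
  have h₃ := (hR.const_mul 2).mul (v₃.sub ((q alpha2).const_mul (alpha3 b c)))
  have h := (h₁.add h₂).add h₃
  refine h.congr_deriv ?_
  simp [phiPoly, phiPoly']
  ring

/-- The value of `h₂(X, b)`, as a polynomial. -/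
noncomputable def flatPoly (x b : R8) : ℝ :=
  2 * R x * eucl (X x) b - 2 * alpha1 x (X x) * alpha1 x b
    - alpha2 x (X x) * alpha2 x b - alpha3 x (X x) * alpha3 x b

/-- The derivative of `flatPoly` at `x` in the direction `e`. -/
noncomputable def flatPoly' (x e b : R8) : ℝ :=
  4 * eucl x e * eucl (X x) b + 2 * R x * eucl (X e) b
    - 2 * (alpha1 e (X x) + alpha1 x (X e)) * alpha1 x b - 2 * alpha1 x (X x) * alpha1 e b
    - (alpha2 e (X x) + alpha2 x (X e)) * alpha2 x b - alpha2 x (X x) * alpha2 e b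
    - (alpha3 e (X x) + alpha3 x (X e)) * alpha3 x b - alpha3 x (X x) * alpha3 e b

theorem hasDerivAt_X_line (x e : R8) : HasDerivAt (fun t : ℝ => X (x + t • e)) (X e) 0 :=
  hasDerivAt_clm_line XL x e

theorem hasDerivAt_flatPoly (x e : R8) {f : ℝ → R8} {f' : R8} (hf : HasDerivAt f f' 0) :
    HasDerivAt (fun t : ℝ => flatPoly (x + t • e) (f t))
      (flatPoly' x e (f 0) + flatPoly x f') 0 := by
  have hR := hasDerivAt_R_line x e
  have q := fun (A : R8 →L[ℝ] R8 →L[ℝ] ℝ) => hasDerivAt_bilin_line A x e hf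
  have p := fun (A : R8 →L[ℝ] R8 →L[ℝ] ℝ) => hasDerivAt_bilin_line A x e (hasDerivAt_X_line x e)
  have r := hasDerivAt_bilin_line (eucl.comp XL) x e hf
  have h := ((((hR.const_mul 2).mul r).sub (((p alpha1).const_mul 2).mul (q alpha1))).sub
    ((p alpha2).mul (q alpha2))).sub ((p alpha3).mul (q alpha3))
  refine h.congr_deriv ?_
  have hX : ∀ y, XL y = X y := fun y => rfl
  simp [flatPoly, flatPoly', hX]
  ring

theorem flatPoly_eq {x : R8} (hx : R x ≠ 0) (b : R8) : h2 x (X x) b = flatPoly x b := by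
  rw [h2_apply hx, eucl_X, flatPoly]
  ring

/-- θ carries a factor N⁻¹, and √N · N⁻¹ = N^{-1/2}. -/
theorem scaledPsiUp_apply {x : R8} (hx : Q x ∈ smoothLocus) (a b c : R8) :
    scaledPsiUp x ![a, b, c] = √(flatPoly x (X x)) * phiPoly x a b c
      - (√(flatPoly x (X x)))⁻¹ * (flatPoly x a * phiPoly x (X x) b c
        - flatPoly x b * phiPoly x (X x) a c + flatPoly x c * phiPoly x (X x) a b) := by
  have hR := (R_pos hx).ne'
  have hN := normSqX_pos hx
  have e : normSqX x = flatPoly x (X x) := flatPoly_eq hR _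
  have f : ∀ a b c, phi x ![a, b, c] = phiPoly x a b c := fun a b c => phi_apply hR a b c
  have hs : √(flatPoly x (X x)) ≠ 0 := (Real.sqrt_pos.2 (e ▸ hN)).ne'
  have hq : flatPoly x (X x) = √(flatPoly x (X x)) ^ 2 := (Real.sq_sqrt (e ▸ hN).le).symm
  simp only [scaledPsiUp, ContinuousAlternatingMap.smul_apply, ContinuousAlternatingMap.sub_apply,
    wedge_two_apply, contractedForm_apply, theta_apply, flatPoly_eq hR, f, e, smul_eq_mul]
  have : (flatPoly x (X x))⁻¹ = (√(flatPoly x (X x)))⁻¹ ^ 2 := by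
    rw [inv_pow, ← hq]
  rw [this]
  field_simp

/-- The derivative of `scaledPsiUp` in the direction `e` at a point with `N = 36`. -/
noncomputable def scaledPsiUp' (x e a b c : R8) : ℝ :=
  6 * phiPoly' x e a b c + (flatPoly' x e (X x) + flatPoly x (X e)) / 12 * phiPoly x a b c
    - 1 / 6 * (flatPoly' x e a * phiPoly x (X x) b c
        + flatPoly x a * (phiPoly' x e (X x) b c + phiPoly x (X e) b c)
        - flatPoly' x e b * phiPoly x (X x) a c
        - flatPoly x b * (phiPoly' x e (X x) a c + phiPoly x (X e) a c)
        + flatPoly' x e c * phiPoly x (X x) a b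
        + flatPoly x c * (phiPoly' x e (X x) a b + phiPoly x (X e) a b))
    + (flatPoly' x e (X x) + flatPoly x (X e)) / 432 * (flatPoly x a * phiPoly x (X x) b c
        - flatPoly x b * phiPoly x (X x) a c + flatPoly x c * phiPoly x (X x) a b)

theorem fderiv_scaledPsiUp_apply {x : R8} (hx : Q x ∈ smoothLocus) (h : flatPoly x (X x) = 36)
    (e a b c : R8) :
    fderiv ℝ (fun y => scaledPsiUp y ![a, b, c]) x e = scaledPsiUp' x e a b c := by
  have hd := ((contDiffAt_scaledPsiUp hx).differentiableAt
    (by simp)).continuousAlternatingMap_apply_const ![a, b, c]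
  have h0 : x + (0 : ℝ) • e = x := by simp
  have h1 : HasDerivAt (fun t : ℝ => scaledPsiUp (x + t • e) ![a, b, c])
      (fderiv ℝ (fun y => scaledPsiUp y ![a, b, c]) x e) 0 := by
    have hd' := hd.hasFDerivAt
    rw [← h0] at hd'
    have := hd'.comp_hasDerivAt (0 : ℝ) (hasDerivAt_line x e)
    rwa [h0] at this
  have s6 : √(36 : ℝ) = 6 := by
    rw [Real.sqrt_eq_iff_eq_sq] <;> norm_num
  have n := hasDerivAt_flatPoly x e (hasDerivAt_X_line x e)
  have k := fun b : R8 => hasDerivAt_flatPoly x e (hasDerivAt_const (0 : ℝ) b)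
  have p := fun a b c : R8 => hasDerivAt_phiPoly x e b c (hasDerivAt_const (0 : ℝ) a)
  have q := fun b c : R8 => hasDerivAt_phiPoly x e b c (hasDerivAt_X_line x e)
  -- At N = 36 the derivatives of √N and N^{-1/2} are N′/12 and −N′/432.
  have ns := n.sqrt (by rw [h0, h]; norm_num)
  have h2 := (ns.mul (p a b c)).sub ((ns.inv (by rw [h0, h, s6]; norm_num)).mul
    ((((k a).mul (q b c)).sub ((k b).mul (q a c))).add ((k c).mul (q a b))))
  have ev : (fun t : ℝ => scaledPsiUp (x + t • e) ![a, b, c]) =ᶠ[nhds 0] fun t =>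
      √(flatPoly (x + t • e) (X (x + t • e))) * phiPoly (x + t • e) a b c
        - (√(flatPoly (x + t • e) (X (x + t • e))))⁻¹ *
          (flatPoly (x + t • e) a * phiPoly (x + t • e) (X (x + t • e)) b c
            - flatPoly (x + t • e) b * phiPoly (x + t • e) (X (x + t • e)) a c
            + flatPoly (x + t • e) c * phiPoly (x + t • e) (X (x + t • e)) a b) := by
    have hc : ContinuousAt (fun t : ℝ => Q (x + t • e)) 0 :=
      contDiff_Q.continuous.continuousAt.comp (hasDerivAt_line x e).continuousAt
    filter_upwards [hc.preimage_mem_nhds (by rw [h0]; exact isOpen_smoothLocus.mem_nhds hx)]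
      with t ht using scaledPsiUp_apply ht a b c
  refine h1.unique ((h2.congr_of_eventuallyEq ev).congr_deriv ?_)
  -- Constant slots have zero velocity, so their terms drop out.
  have z : ∀ u v w, phiPoly u 0 v w = 0 := fun u v w => by simp [phiPoly]
  have z' : ∀ u, flatPoly u 0 = 0 := fun u => by simp [flatPoly]
  simp only [Pi.sub_apply, Pi.mul_apply, Pi.add_apply, Pi.inv_apply, h0, h, s6, z, z', scaledPsiUp']
  ring

/-- The four derivatives that make up `extDeriv scaledPsiUp x ![a, b, c, d]` where `N = 36`. -/
theorem extDeriv_scaledPsiUp_apply {x : R8} (hx : Q x ∈ smoothLocus) (h : flatPoly x (X x) = 36)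
    (a b c d : R8) : extDeriv scaledPsiUp x ![a, b, c, d] = scaledPsiUp' x a b c d
      - scaledPsiUp' x b a c d + scaledPsiUp' x c a b d - scaledPsiUp' x d a b c := by
  rw [extDeriv_three_apply ((contDiffAt_scaledPsiUp hx).differentiableAt (by simp))]
  simp only [fderiv_scaledPsiUp_apply hx h]

/-- Positive first coordinates keep 𝐮 and 𝐯 off the negative axis, where `section6` is not
available. -/
theorem extDeriv_scaledPsi_ne_zero_of_apply {x : R8} {U V : Fin 3 → ℝ} (hQ : Q x = (U, V))
    (hU : 0 < U 0) (hV : 0 < V 0) (h : flatPoly x (X x) = 36) (a b c d : R8)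
    (hd : scaledPsiUp' x a b c d - scaledPsiUp' x b a c d + scaledPsiUp' x c a b d
      - scaledPsiUp' x d a b c ≠ 0) : extDeriv scaledPsi (U, V) ≠ 0 := by
  have hU0 : U ≠ 0 := fun h => hU.ne' (congrFun h 0)
  have hV0 : V ≠ 0 := fun h => hV.ne' (congrFun h 0)
  have hx : Q x ∈ smoothLocus := hQ ▸ ⟨hU0, hV0⟩
  rw [← hQ]
  refine extDeriv_scaledPsi_ne_zero hx ?_ ?_ fun h0 => hd ?_
  · rw [hQ]; exact add_pos (len_pos hU0) hU
  · rw [hQ]; exact add_pos (len_pos hV0) hV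
  · rw [← extDeriv_scaledPsiUp_apply hx h, h0]; rfl

/-! ### Numerical evaluation at the two points -/

/-- The standard basis vectors that occur in the evaluations below. -/
def basis8 : Fin 6 → R8 :=
  ![![1, 0, 0, 0, 0, 0, 0, 0], ![0, 1, 0, 0, 0, 0, 0, 0], ![0, 0, 1, 0, 0, 0, 0, 0],
    ![0, 0, 0, 1, 0, 0, 0, 0], ![0, 0, 0, 0, 1, 0, 0, 0], ![0, 0, 0, 0, 0, 1, 0, 0]]

/-- A point over `(![1, 2, 2], ![1, 2, 2])`. -/
noncomputable def point122 : R8 := ![1, 1, 1, 1, 0, 1, 0, 1]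

theorem scaledPsiUp'_point122_0 :
    scaledPsiUp' point122 (basis8 0) (basis8 1) (basis8 2) (basis8 5) = -24 := by
  simp [point122, basis8, scaledPsiUp', phiPoly, phiPoly', flatPoly, flatPoly', eucl_apply,
    alpha1_apply, alpha2_apply, alpha3_apply, R_eq, X]
  norm_num

theorem scaledPsiUp'_point122_1 :
    scaledPsiUp' point122 (basis8 1) (basis8 0) (basis8 2) (basis8 5) = -8 := by
  simp [point122, basis8, scaledPsiUp', phiPoly, phiPoly', flatPoly, flatPoly', eucl_apply,
    alpha1_apply, alpha2_apply, alpha3_apply, R_eq, X]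
  norm_num

theorem scaledPsiUp'_point122_2 :
    scaledPsiUp' point122 (basis8 2) (basis8 0) (basis8 1) (basis8 5) = 96 := by
  simp [point122, basis8, scaledPsiUp', phiPoly, phiPoly', flatPoly, flatPoly', eucl_apply,
    alpha1_apply, alpha2_apply, alpha3_apply, R_eq, X]
  norm_num

theorem scaledPsiUp'_point122_5 :
    scaledPsiUp' point122 (basis8 5) (basis8 0) (basis8 1) (basis8 2) = -16 := by
  simp [point122, basis8, scaledPsiUp', phiPoly, phiPoly', flatPoly, flatPoly', eucl_apply,
    alpha1_apply, alpha2_apply, alpha3_apply, R_eq, X]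
  norm_num

theorem extDeriv_scaledPsi_ne_zero_one_two_two :
    extDeriv scaledPsi (![1, 2, 2], ![1, 2, 2]) ≠ 0 := by
  refine extDeriv_scaledPsi_ne_zero_of_apply (x := point122) ?_ (by norm_num) (by norm_num) ?_
    (basis8 0) (basis8 1) (basis8 2) (basis8 5) ?_
  · simp [point122, Q]
  · simp [point122, flatPoly, eucl_apply, alpha1_apply, alpha2_apply, alpha3_apply, R_eq, X]
    norm_num
  -- The alternating sum is −24 + 8 + 96 + 16 = 96.
  · rw [scaledPsiUp'_point122_0, scaledPsiUp'_point122_1, scaledPsiUp'_point122_2,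
      scaledPsiUp'_point122_5]
    norm_num

/-- A point over `(![2, 2, 1], ![2, 2, 1])`. -/
noncomputable def point221 : R8 := ![3 / 2, 1 / 2, 3 / 2, 1 / 2, 1 / 2, 1 / 2, 1 / 2, 1 / 2]

theorem scaledPsiUp'_point221_0 :
    scaledPsiUp' point221 (basis8 0) (basis8 2) (basis8 4) (basis8 5) = 220 := by
  simp [point221, basis8, scaledPsiUp', phiPoly, phiPoly', flatPoly, flatPoly', eucl_apply,
    alpha1_apply, alpha2_apply, alpha3_apply, R_eq, X]
  norm_num

theorem scaledPsiUp'_point221_2 :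
    scaledPsiUp' point221 (basis8 2) (basis8 0) (basis8 4) (basis8 5) = 216 := by
  simp [point221, basis8, scaledPsiUp', phiPoly, phiPoly', flatPoly, flatPoly', eucl_apply,
    alpha1_apply, alpha2_apply, alpha3_apply, R_eq, X]
  norm_num

theorem scaledPsiUp'_point221_4 :
    scaledPsiUp' point221 (basis8 4) (basis8 0) (basis8 2) (basis8 5) = -110 := by
  simp [point221, basis8, scaledPsiUp', phiPoly, phiPoly', flatPoly, flatPoly', eucl_apply,
    alpha1_apply, alpha2_apply, alpha3_apply, R_eq, X]
  norm_num

theorem scaledPsiUp'_point221_5 :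
    scaledPsiUp' point221 (basis8 5) (basis8 0) (basis8 2) (basis8 4) = 110 := by
  simp [point221, basis8, scaledPsiUp', phiPoly, phiPoly', flatPoly, flatPoly', eucl_apply,
    alpha1_apply, alpha2_apply, alpha3_apply, R_eq, X]
  norm_num

theorem extDeriv_scaledPsi_ne_zero_two_two_one :
    extDeriv scaledPsi (![2, 2, 1], ![2, 2, 1]) ≠ 0 := by
  refine extDeriv_scaledPsi_ne_zero_of_apply (x := point221) ?_ (by norm_num) (by norm_num) ?_
    (basis8 0) (basis8 2) (basis8 4) (basis8 5) ?_
  · simp [point221, Q]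
    norm_num
  · simp [point221, flatPoly, eucl_apply, alpha1_apply, alpha2_apply, alpha3_apply, R_eq, X]
    norm_num
  -- The alternating sum is 220 − 216 − 110 − 110 = −216.
  · rw [scaledPsiUp'_point221_0, scaledPsiUp'_point221_2, scaledPsiUp'_point221_4,
      scaledPsiUp'_point221_5]
    norm_num

end G2Cone

theorem corollary7p9 :
    -- the tensors of the quotient are well defined at each point of its smooth locus
    (∀ m ∈ smoothLocus,
      (∃! c, IsPushdownFun normSqX m c) ∧
      (∃! b, IsPushdownBilin horizontalMetric m b) ∧
      (∃! β, IsPushdownForm contractedForm m β) ∧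
      (∃! β, IsPushdownForm psiMinusUp m β) ∧
      (∃! A, IsInducedJ m A)) ∧
    -- `J` is a smooth almost complex structure
    (∀ m ∈ smoothLocus, (J m).comp (J m) = -ContinuousLinearMap.id ℝ R6) ∧
    ContDiffOn ℝ ∞ J smoothLocus ∧
    -- `J` is not integrable: there are no holomorphic coordinates, the Nijenhuis tensor is not zero
    ¬ IsIntegrableOn J smoothLocus ∧
    (∃ m ∈ smoothLocus, ∃ v w : R6, nijenhuis J m v w ≠ 0) ∧
    -- `d(N^{-1/4} ψ⁻)` is not zero at two explicit points
    extDeriv (fun m => (N m ^ (-(1 / 4) : ℝ)) • psiMinus m) (![1, 2, 2], ![1, 2, 2]) ≠ 0 ∧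
    extDeriv (fun m => (N m ^ (-(1 / 4) : ℝ)) • psiMinus m) (![2, 2, 1], ![2, 2, 1]) ≠ 0 := by
  refine ⟨fun m hm => ⟨existsUnique_pushdownFun_normSqX hm,
    existsUnique_pushdownBilin_horizontalMetric hm, existsUnique_pushdownForm_contractedForm hm,
    existsUnique_pushdownForm_psiMinusUp hm, existsUnique_isInducedJ hm⟩, fun m hm => J_comp_J hm,
    contDiffOn_J, not_isIntegrableOn_J, ⟨axisPoint, axisPoint_mem, (![1, 0, 0], 0), (![0, 1, 0], 0),
    fun h => ?_⟩, extDeriv_scaledPsi_ne_zero_one_two_two, extDeriv_scaledPsi_ne_zero_two_two_one⟩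
  have h1 := nijenhuis_axisPoint
  rw [h] at h1
  norm_num at h1
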